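/- Let $d\ge 1$ be an integer and let $\mathcal L_d=\frac1d\mathbb Z\times\frac1d\mathbb Z$. A (closed, nondegenerate) triangle $T\subset\mathbb R^2$ is called \emph{$d$-minimal} if $T\cap\mathcal L_d$ consists precisely of the three vertices of $T$. Let $G=GL_2(\mathbb Z)\rtimes\mathbb Z^2$ act on $\mathbb R^2$ by $x\mapsto Ux+v$ for $U\in GL_2(\mathbb Z)$, $v\in\mathbb Z^2$; the maps of this form are called $G$-maps. Two subsets of $\mathbb R^2$ are \emph{$G$-equivalent} if some $G$-map carries one onto the other. For points $p=(w/d,x/d)$ and $q=(y/d,z/d)$ of $\mathcal L_d$, put $W(E_{p\to q})=\det\begin{pmatrix} w&y\\ x&z\end{pmatrix}\bmod d\in\mathbb Z/d\mathbb Z$. For a $d$-minimal triangle $T$ whose vertices in counterclockwise order are $p,q,r$, let the weight $W(T)$ be the unordered multiset $\{W(E_{p\to q}),W(E_{q\to r}),W(E_{r\to p})\}$ of elements of $\mathbb Z/d\mathbb Z$. Two sets $P,Q\subset\mathbb R^2$ are \emph{finitely rationally discretely equidecomposable} if there are finitely many open simplices $T_1,\dots,T_r$ (of dimension $0$, $1$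 or $2$; an open simplex is the relative interior of a simplex, and a $0$-simplex is a point), all with rational vertices, and $G$-maps $g_1,\dots,g_r$ such that $P=\bigsqcup_{i=1}^r T_i$ and $Q=\bigsqcup_{i=1}^r g_i(T_i)$, where $\bigsqcup$ denotes disjoint union. \textbf{Corollary.} Let $S$ and $T$ be $d$-minimal triangles. Then the following are equivalent: \begin{enumerate} \item $S$ and $T$ are $G$-equivalent. \item $W(S)=W(T)$. \item $S$ and $T$ are finitely rationally discretely equidecomposable. \end{enumerate} -/

import Mathlib

open scoped Matrix

noncomputable section

namespace DiscreteEqui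

/-- The plane `ℝ²`. -/
abbrev Plane : Type := Fin 2 → ℝ

/-- The action `x ↦ U x + v` of the element `U ⋊ v` of the affine unimodular group
`G = GL₂(ℤ) ⋊ ℤ²` on the plane. -/
def gMap (U : GL (Fin 2) ℤ) (v : Fin 2 → ℤ) (x : Plane) : Plane :=
  (U : Matrix (Fin 2) (Fin 2) ℤ).map (Int.cast : ℤ → ℝ) *ᵥ x + fun i => (v i : ℝ)

/-- A `G`-map is a transformation of the plane induced by an element of `G`. -/
def IsGMap (f : Plane → Plane) : Prop :=
  ∃ (U : GL (Fin 2) ℤ) (v : Fin 2 → ℤ), f = gMap U v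

/-- Two regions are `G`-equivalent if some element of `G` carries one onto the other. -/
def GEquivalent (P Q : Set Plane) : Prop :=
  ∃ g : Plane → Plane, IsGMap g ∧ g '' P = Q

/-- The lattice `𝓛_d = (1/d)ℤ × (1/d)ℤ`. -/
def lattice (d : ℕ) : Set Plane :=
  {x | ∃ a : Fin 2 → ℤ, ∀ i, x i = (a i : ℝ) / (d : ℝ)}

/-- The closed triangular region spanned by the vertices of a (nondegenerate) triangle. -/
def region (T : Affine.Triangle ℝ Plane) : Set Plane :=
  convexHull ℝ (Set.range T.points)

/-- A triangle is `d`-minimal if it meets `𝓛_d` precisely in its vertices. -/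
def IsMinimal (d : ℕ) (T : Affine.Triangle ℝ Plane) : Prop :=
  region T ∩ lattice d = Set.range T.points

/-- The integer coordinates `d • p` of a point `p` of `𝓛_d`
(the floor does nothing at points of the lattice, see `coord_eq`). -/
def coord (d : ℕ) (p : Plane) (i : Fin 2) : ℤ := ⌊(d : ℝ) * p i⌋

theorem coord_eq {d : ℕ} (hd : 0 < d) {p : Plane} {a : Fin 2 → ℤ}
    (h : ∀ i, p i = (a i : ℝ) / (d : ℝ)) : coord d p = a := by
  funext i
  have hd' : (d : ℝ) ≠ 0 := by exact_mod_cast hd.ne'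
  rw [coord, h i, mul_div_cancel₀ _ hd', Int.floor_intCast]

/-- The weight of the oriented edge from `p = (w/d, x/d)` to `q = (y/d, z/d)`:
the residue modulo `d` of the determinant of the matrix with columns `(w, x)` and `(y, z)`. -/
def edgeWeight (d : ℕ) (p q : Plane) : ZMod d :=
  ((!![coord d p 0, coord d q 0; coord d p 1, coord d q 1].det : ℤ) : ZMod d)

/-- The vertices `p, q, r` are listed in counterclockwise order. -/
def IsCounterclockwise (p q r : Plane) : Prop :=
  0 < !![q 0 - p 0, r 0 - p 0; q 1 - p 1, r 1 - p 1].det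

open Classical in
/-- The weight of a triangle: the multiset of the weights of its three edges, each given the
orientation induced by the counterclockwise orientation of the triangle. If the labelling of the
vertices of `T` is clockwise, then the reversed labelling is counterclockwise. -/
def weight (d : ℕ) (T : Affine.Triangle ℝ Plane) : Multiset (ZMod d) :=
  if IsCounterclockwise (T.points 0) (T.points 1) (T.points 2) then
    {edgeWeight d (T.points 0) (T.points 1), edgeWeight d (T.points 1) (T.points 2),
      edgeWeight d (T.points 2) (T.points 0)}
  else
    {edgeWeight d (T.points 0) (T.points 2), edgeWeight d (T.points 2) (T.points 1),
      edgeWeight d (T.points 1) (T.points 0)}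

/-- The open simplex with vertices `v 0, …, v k`: all convex combinations with strictly positive
coefficients. For `k = 0` this is the single point `v 0`. -/
def openSimplex {k : ℕ} (v : Fin (k + 1) → Plane) : Set Plane :=
  {x | ∃ w : Fin (k + 1) → ℝ, (∀ i, 0 < w i) ∧ ∑ i, w i = 1 ∧ ∑ i, w i • v i = x}

/-- A rational open simplex (of any dimension, which in the plane is `0`, `1` or `2`): the open
simplex on affinely independent vertices with rational coordinates. -/
def IsRationalOpenSimplex (A : Set Plane) : Prop :=
  ∃ (k : ℕ) (v : Fin (k + 1) → Plane), AffineIndependent ℝ v ∧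
    (∀ i j, ∃ c : ℚ, v i j = (c : ℝ)) ∧ A = openSimplex v

/-- Finite rational discrete equidecomposability: `P` is the disjoint union of finitely many
rational open simplices `A i`, and `Q` is the disjoint union of their images `g i (A i)` under
`G`-maps `g i`. -/
def FiniteRationalEquidecomposable (P Q : Set Plane) : Prop :=
  ∃ (r : ℕ) (A : Fin r → Set Plane) (g : Fin r → Plane → Plane),
    (∀ i, IsRationalOpenSimplex (A i)) ∧ (∀ i, IsGMap (g i)) ∧
    Pairwise (fun i j => Disjoint (A i) (A j)) ∧ P = ⋃ i, A i ∧
    Pairwise (fun i j => Disjoint (g i '' A i) (g j '' A j)) ∧ Q = ⋃ i, g i '' A i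

end DiscreteEqui

end

noncomputable section

namespace DiscreteEqui

open MeasureTheory Filter Topology Set

/-! Everything is read off the barycentric coordinates of the origin with respect to a `d`-minimal
triangle. Scaled by `d`, such a triangle is a lattice triangle of area `1/2`
(`exists_vertices_of_minimal`), so these coordinates are integers, and modulo `d` they are the edge
weights (`weight_eq`).

Equal weights give `G`-equivalence: a unimodular affine map matches the scaled vertices, and
expanding the origin in both triangles shows that its translation part is divisible by `d`. It
therefore descends to a `G`-map (`gEquivalent_of_originCoord`). A `G`-map carries the open faces
along, which gives an equidecomposition.

The remaining implication needs an invariant of equidecomposition. For a primitive integral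
direction `u`, the length of the intersection of `P` with the line `cross u x = s`, in units of `u`,
is a function of `s`. Its right jumps are additive over disjoint convex pieces, and `G` permutes the
pairs `(u, s)` while preserving `s` modulo `ℤ`. Hence the sum of the jumps over all `u` and all `s ∈
γ + ℤ` is invariant (`totalJump_eq_of_equidecomposable`). A closed `d`-minimal triangle jumps by
`-1/d` once per edge, at a level given by the weight of that edge, so the invariant at `γ = a/d`
counts the edges of weight `a` (`totalJump_region`). -/

/-! ### Coordinates adapted to a direction -/

/-- The determinant of the matrix with columns `x` and `y`. -/
def cross {R : Type*} [CommRing R] (x y : Fin 2 → R) : R := x 0 * y 1 - x 1 * y 0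

/-- The inclusion of the integral vectors in the plane. -/
def toPlane (u : Fin 2 → ℤ) : Plane := fun i => (u i : ℝ)

theorem cross_toPlane (u w : Fin 2 → ℤ) : cross (toPlane u) (toPlane w) = (cross u w : ℤ) := by
  simp [cross, toPlane]

theorem toPlane_ne_zero {u : Fin 2 → ℤ} (hu : u ≠ 0) : toPlane u ≠ 0 := fun h => hu <| by
  funext i
  simpa [toPlane] using congrFun h i

/-- A vector `n` with `cross u n = 1`, for `u ≠ 0`. -/
def dual (u : Plane) : Plane := ![-u 1 / (u 0 ^ 2 + u 1 ^ 2), u 0 / (u 0 ^ 2 + u 1 ^ 2)]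

theorem sq_add_sq_ne_zero {u : Plane} (hu : u ≠ 0) : u 0 ^ 2 + u 1 ^ 2 ≠ 0 := fun h => hu <| by
  have h0 : u 0 = 0 := by nlinarith [sq_nonneg (u 0), sq_nonneg (u 1)]
  have h1 : u 1 = 0 := by nlinarith [sq_nonneg (u 0), sq_nonneg (u 1)]
  funext i
  fin_cases i <;> simpa

theorem cross_dual {u : Plane} (hu : u ≠ 0) : cross u (dual u) = 1 := by
  have := sq_add_sq_ne_zero hu
  simp only [cross, dual, Matrix.cons_val_zero, Matrix.cons_val_one]
  field_simp
  ring

theorem cross_smul_dual_add {u : Plane} (hu : u ≠ 0) (s t : ℝ) :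
    cross u (s • dual u + t • u) = s := by
  have := cross_dual hu
  simp only [cross, Pi.add_apply, Pi.smul_apply, smul_eq_mul] at this ⊢
  linear_combination s * this

theorem cross_add_smul_dual {u : Plane} (hu : u ≠ 0) (s t : ℝ) :
    cross (s • dual u + t • u) (dual u) = t := by
  have := cross_dual hu
  simp only [cross, Pi.add_apply, Pi.smul_apply, smul_eq_mul] at this ⊢
  linear_combination t * this

theorem eq_smul_dual_add {u : Plane} (hu : u ≠ 0) (x : Plane) :
    x = cross u x • dual u + cross x (dual u) • u := by
  have := cross_dual hu
  funext i
  fin_cases i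
  · simp only [cross, Pi.add_apply, Pi.smul_apply, smul_eq_mul, Fin.zero_eta] at this ⊢
    linear_combination (-x 0) * this
  · simp only [cross, Pi.add_apply, Pi.smul_apply, smul_eq_mul, Fin.mk_one] at this ⊢
    linear_combination (-x 1) * this

@[fun_prop]
theorem continuous_cross (u : Plane) : Continuous fun x : Plane => cross u x := by
  unfold cross
  fun_prop

/-! ### Chords and their lengths -/

/-- The parameters of the points of `P` on the line through `x` in direction `u`. -/
def chord (P : Set Plane) (u x : Plane) : Set ℝ := {t | x + t • u ∈ P}

/-- The length, in units of `u`, of the intersection of `P` with the line `cross u x = s`. -/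
def chordLength (u : Plane) (P : Set Plane) (s : ℝ) : ℝ := volume.real (chord P u (s • dual u))

/-- Changing the base point on a line translates the parameter, and Lebesgue measure is translation
invariant. -/
theorem chordLength_eq {u : Plane} (hu : u ≠ 0) (P : Set Plane) (x : Plane) :
    chordLength u P (cross u x) = volume.real (chord P u x) := by
  have h : chord P u x = (fun t => t + cross x (dual u)) ⁻¹' chord P u (cross u x • dual u) := by
    ext t
    simp only [chord, mem_ofPred_eq, mem_preimage]
    rw [show x + t • u = cross u x • dual u + (t + cross x (dual u)) • u by
      conv_lhs => rw [eq_smul_dual_add hu x]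
      module]
  rw [chordLength, h, Measure.real, Measure.real, measure_preimage_add_right]

theorem chordLength_neg_eq {u : Plane} (hu : u ≠ 0) (P : Set Plane) (x : Plane) :
    chordLength u P (cross u x) = volume.real (chord P (-u) x) := by
  have h : chord P (-u) x = (fun t => -t) ⁻¹' chord P u x := by
    ext t
    simp [chord]
  rw [chordLength_eq hu, h, Measure.real, Measure.real, Measure.measure_preimage_neg]

theorem chordLength_neg {u : Plane} (hu : u ≠ 0) (P : Set Plane) (s : ℝ) :
    chordLength (-u) P (-s) = chordLength u P s := by
  have h1 := chordLength_neg_eq hu P (s • dual u)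
  have h2 := chordLength_eq (neg_ne_zero.2 hu) P (s • dual u)
  have h3 : cross u (s • dual u) = s := by simpa using cross_smul_dual_add hu s 0
  have h4 : cross (-u) (s • dual u) = -s := by
    have : cross (-u) (s • dual u) = -cross u (s • dual u) := by
      simp only [cross, Pi.neg_apply]
      ring
    rw [this, h3]
  rw [h3] at h1
  rw [h4] at h2
  rw [h1, h2]

theorem measurableSet_chord {P : Set Plane} (hP : Convex ℝ P) (u x : Plane) :
    MeasurableSet (chord P u x) := by
  have : Convex ℝ (chord P u x) := by
    intro s hs t ht a b ha hb hab
    have := hP hs ht ha hb hab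
    simp only [chord, mem_ofPred_eq]
    convert this using 1
    rw [← eq_sub_iff_add_eq'] at hab
    subst hab
    simp only [smul_eq_mul]
    module
  exact this.ordConnected.measurableSet

theorem exists_chord_subset {P : Set Plane} (hP : Bornology.IsBounded P) {u : Plane} (hu : u ≠ 0) :
    ∃ M : ℝ, ∀ s : ℝ, chord P u (s • dual u) ⊆ Icc (-M) M := by
  obtain ⟨R, hR⟩ := hP.exists_norm_le
  refine ⟨R * |dual u 1| + R * |dual u 0|, fun s t ht => ?_⟩
  have hx : ‖s • dual u + t • u‖ ≤ R := hR _ ht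
  set x := s • dual u + t • u with hxdef
  have ht' : t = cross x (dual u) := (cross_add_smul_dual hu s t).symm
  have h0 : |x 0| ≤ R := (norm_le_pi_norm x 0).trans hx
  have h1 : |x 1| ≤ R := (norm_le_pi_norm x 1).trans hx
  rw [mem_Icc, ← abs_le, ht', cross]
  calc _ ≤ |x 0 * dual u 1| + |x 1 * dual u 0| := abs_sub _ _
    _ ≤ _ := by rw [abs_mul, abs_mul]; gcongr

theorem volume_chord_ne_top {P : Set Plane} (hP : Bornology.IsBounded P) {u : Plane} (hu : u ≠ 0)
    (s : ℝ) : volume (chord P u (s • dual u)) ≠ ⊤ := by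
  obtain ⟨M, hM⟩ := exists_chord_subset hP hu
  exact ((measure_mono (hM s)).trans_lt (by simp)).ne

/-! ### One-sided limits and jumps of the chord length -/

theorem eventually_or_eventually_not {I : Set ℝ} (hI : I.OrdConnected) (c : ℝ) :
    (∀ᶠ s in 𝓝[>] c, s ∈ I) ∨ ∀ᶠ s in 𝓝[>] c, s ∉ I := by
  by_cases h : ∀ᶠ s in 𝓝[>] c, s ∉ I
  · exact Or.inr h
  left
  have hf : ∃ᶠ s in 𝓝[>] c, s ∈ I := fun h' => h h'
  obtain ⟨s₁, h₁, hc⟩ := (hf.and_eventually self_mem_nhdsWithin).exists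
  filter_upwards [Ioo_mem_nhdsGT hc] with s hs
  obtain ⟨s₀, h₀, hs₀⟩ := (hf.and_eventually (Ioo_mem_nhdsGT hs.1)).exists
  exact hI.out h₀ h₁ ⟨hs₀.2.le, hs.2.le⟩

/-- By convexity, for fixed `t` the levels `s` whose chord contains `t` form an interval, so
membership stabilises as `s` decreases to `c`. All chords lie in one bounded interval, so dominated
convergence applies. -/
theorem exists_tendsto_chordLength {P : Set Plane} (hc : Convex ℝ P) (hb : Bornology.IsBounded P)
    {u : Plane} (hu : u ≠ 0) (c : ℝ) : ∃ l, Tendsto (chordLength u P) (𝓝[>] c) (𝓝 l) := by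
  obtain ⟨M, hM⟩ := exists_chord_subset hb hu
  set A : Set ℝ := {t | ∀ᶠ s in 𝓝[>] c, t ∈ chord P u (s • dual u)} with hA
  have hAc : A.OrdConnected := by
    refine Convex.ordConnected (s := A) ?_
    intro s hs t ht a b ha hb hab
    simp only [hA, mem_ofPred_eq] at hs ht ⊢
    filter_upwards [hs, ht] with r hr hr'
    have := hc hr hr' ha hb hab
    simp only [chord, mem_ofPred_eq]
    convert this using 1
    rw [← eq_sub_iff_add_eq'] at hab
    subst hab
    simp only [smul_eq_mul]
    module
  have hlim : ∀ t, ∀ᶠ s in 𝓝[>] c, (t ∈ chord P u (s • dual u) ↔ t ∈ A) := by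
    intro t
    have hI : {s : ℝ | t ∈ chord P u (s • dual u)}.OrdConnected := by
      refine Convex.ordConnected (s := {s : ℝ | t ∈ chord P u (s • dual u)}) ?_
      intro r hr s hs a b ha hb hab
      have := hc hr hs ha hb hab
      simp only [chord, mem_ofPred_eq]
      convert this using 1
      rw [← eq_sub_iff_add_eq'] at hab
      subst hab
      simp only [smul_eq_mul]
      module
    rcases eventually_or_eventually_not hI c with h | h
    · have ht : t ∈ A := h
      filter_upwards [h] with s hs
      exact ⟨fun _ => ht, fun _ => hs⟩
    · have ht : t ∉ A := fun h' => by
        obtain ⟨s, h1, h2⟩ := (h.and h').exists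
        exact h1 h2
      filter_upwards [h] with s hs
      exact ⟨fun h' => absurd h' hs, fun h' => absurd h' ht⟩
  have := tendsto_measure_of_ae_tendsto_indicator (μ := volume) (𝓝[>] c) hAc.measurableSet
    (fun s => measurableSet_chord hc u (s • dual u)) (measurableSet_Icc (a := -M) (b := M))
    (by simp) (Eventually.of_forall hM) (Eventually.of_forall hlim)
  have hAM : volume A ≠ ⊤ := by
    have hsub : A ⊆ Icc (-M) M := fun t ht => by
      rw [hA, mem_ofPred_eq] at ht
      obtain ⟨s, hs⟩ := ht.exists
      exact hM s hs
    exact ((measure_mono hsub).trans_lt (by simp)).ne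
  exact ⟨_, (ENNReal.tendsto_toReal hAM).comp this⟩

/-- The jump at `c`, from the right, of the length of the intersection of `P` with the line
`cross u x = s`. -/
def jump (P : Set Plane) (u : Plane) (c : ℝ) : ℝ :=
  lim ((𝓝[>] c).map (chordLength u P)) - chordLength u P c

theorem jump_eq {P : Set Plane} {u : Plane} {c l : ℝ}
    (h : Tendsto (chordLength u P) (𝓝[>] c) (𝓝 l)) : jump P u c = l - chordLength u P c := by
  rw [jump, lim_eq h]

/-- Away from the frontier membership in `P` is locally constant, so the indicators of the chords
converge almost everywhere. -/
theorem jump_eq_zero_of_volume_frontier {P : Set Plane} (hc : Convex ℝ P)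
    (hb : Bornology.IsBounded P) {u : Plane} (hu : u ≠ 0) {c : ℝ}
    (h : volume (chord (frontier P) u (c • dual u)) = 0) : jump P u c = 0 := by
  obtain ⟨M, hM⟩ := exists_chord_subset hb hu
  have hcont (t : ℝ) : Tendsto (fun s : ℝ => s • dual u + t • u) (𝓝[>] c)
      (𝓝 (c • dual u + t • u)) :=
    (Continuous.tendsto (by fun_prop) c).mono_left nhdsWithin_le_nhds
  have hlim : ∀ᵐ t : ℝ, ∀ᶠ s in 𝓝[>] c,
      (t ∈ chord P u (s • dual u) ↔ t ∈ chord P u (c • dual u)) := by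
    filter_upwards [measure_eq_zero_iff_ae_notMem.1 h] with t ht
    by_cases hin : c • dual u + t • u ∈ P
    · have hint : P ∈ 𝓝 (c • dual u + t • u) := by
        rw [← mem_interior_iff_mem_nhds]
        by_contra h'
        exact ht ⟨subset_closure hin, h'⟩
      filter_upwards [hcont t hint] with s hs
      exact ⟨fun _ => hin, fun _ => hs⟩
    · have hint : Pᶜ ∈ 𝓝 (c • dual u + t • u) := by
        rw [← mem_interior_iff_mem_nhds, interior_compl]
        exact fun h' => ht ⟨h', fun h'' => hin (interior_subset h'')⟩
      filter_upwards [hcont t hint] with s hs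
      exact ⟨fun h' => absurd h' hs, fun h' => absurd h' hin⟩
  have := tendsto_measure_of_ae_tendsto_indicator (μ := volume) (𝓝[>] c)
    (measurableSet_chord hc u (c • dual u))
    (fun s => measurableSet_chord hc u (s • dual u)) (measurableSet_Icc (a := -M) (b := M))
    (by simp) (Eventually.of_forall hM) hlim
  rw [jump_eq (l := chordLength u P c)
    ((ENNReal.tendsto_toReal (volume_chord_ne_top hb hu c)).comp this), sub_self]

/-- A set whose boundary lies on finitely many lines has a jump in direction `u` at `c` only if
the line `cross u x = c` is one of them. -/
theorem exists_line_of_jump_ne_zero {P : Set Plane} (hc : Convex ℝ P)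
    (hb : Bornology.IsBounded P) {ι : Type*} [Finite ι] {a : ι → Plane} {b : ι → ℝ}
    (hf : ∀ x ∈ frontier P, ∃ i, cross (a i) x = b i) {u : Plane} (hu : u ≠ 0) {c : ℝ}
    (h : jump P u c ≠ 0) : ∃ i, cross (a i) u = 0 ∧ cross (a i) (c • dual u) = b i := by
  by_contra! hn
  refine h (jump_eq_zero_of_volume_frontier hc hb hu ?_)
  have hsub : chord (frontier P) u (c • dual u) ⊆
      ⋃ i, {t : ℝ | cross (a i) (c • dual u + t • u) = b i} := fun t ht => by
    obtain ⟨i, hi⟩ := hf _ ht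
    exact mem_iUnion.2 ⟨i, hi⟩
  refine measure_mono_null hsub
    ((countable_iUnion fun i => Set.Subsingleton.countable ?_).measure_zero _)
  intro s hs t ht
  have hlin (t : ℝ) : cross (a i) (c • dual u + t • u) = cross (a i) (c • dual u)
      + t * cross (a i) u := by
    simp only [cross, Pi.add_apply, Pi.smul_apply, smul_eq_mul]; ring
  simp only [mem_ofPred_eq, hlin] at hs ht
  -- A line parallel to `u` is distinct from the chord line by `hn` and misses it; a transversal
  -- line meets it in one point.
  by_cases h0 : cross (a i) u = 0
  · exact absurd (by simpa [h0] using hs) (hn i h0)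
  · exact mul_right_cancel₀ h0 (by linarith)

theorem chordLength_iUnion {ι : Type*} [Fintype ι] {A : ι → Set Plane}
    (hc : ∀ i, Convex ℝ (A i)) (hb : ∀ i, Bornology.IsBounded (A i))
    (hd : Pairwise fun i j => Disjoint (A i) (A j)) {u : Plane} (hu : u ≠ 0) (s : ℝ) :
    chordLength u (⋃ i, A i) s = ∑ i, chordLength u (A i) s := by
  have h : chord (⋃ i, A i) u (s • dual u) = ⋃ i, chord (A i) u (s • dual u) := by
    ext t
    simp [chord]
  rw [chordLength, h, measureReal_def, measure_iUnion, tsum_fintype,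
    ENNReal.toReal_sum fun i _ => volume_chord_ne_top (hb i) hu s]
  · rfl
  · exact fun i j hij => (hd hij).preimage (fun t : ℝ => s • dual u + t • u)
  · exact fun i => measurableSet_chord (hc i) _ _

theorem jump_iUnion {ι : Type*} [Fintype ι] {A : ι → Set Plane}
    (hc : ∀ i, Convex ℝ (A i)) (hb : ∀ i, Bornology.IsBounded (A i))
    (hd : Pairwise fun i j => Disjoint (A i) (A j)) {u : Plane} (hu : u ≠ 0) (c : ℝ) :
    jump (⋃ i, A i) u c = ∑ i, jump (A i) u c := by
  choose l hl using fun i => exists_tendsto_chordLength (hc i) (hb i) hu c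
  have h : Tendsto (chordLength u (⋃ i, A i)) (𝓝[>] c) (𝓝 (∑ i, l i)) := by
    rw [funext (chordLength_iUnion hc hb hd hu)]
    exact tendsto_finsetSum _ fun i _ => hl i
  rw [jump_eq h, chordLength_iUnion hc hb hd hu, ← Finset.sum_sub_distrib]
  exact Finset.sum_congr rfl fun i _ => (jump_eq (hl i)).symm

/-! ### Open simplices are polygonal -/

/-- `A` lies between an open set and a closed set cut out by the same functions. The statement thus
serves open and closed triangles alike. -/
theorem exists_eq_zero_of_mem_frontier {ι : Type*} [Finite ι] {f : ι → Plane → ℝ}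
    (hf : ∀ i, Continuous (f i)) {A : Set Plane} (h₁ : ∀ x, (∀ i, 0 < f i x) → x ∈ A)
    (h₂ : ∀ x ∈ A, ∀ i, 0 ≤ f i x) {x : Plane} (hx : x ∈ frontier A) : ∃ i, f i x = 0 := by
  have hclosed : IsClosed {x | ∀ i, 0 ≤ f i x} := by
    simp only [ofPred_forall]
    exact isClosed_iInter fun i => isClosed_le continuous_const (hf i)
  have hopen : IsOpen {x | ∀ i, 0 < f i x} := by
    simp only [ofPred_forall]
    exact isOpen_iInter_of_finite fun i => isOpen_lt continuous_const (hf i)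
  have h1 := closure_minimal (show A ⊆ {x | ∀ i, 0 ≤ f i x} from h₂) hclosed hx.1
  by_contra! h
  exact hx.2 (interior_maximal (show {x | ∀ i, 0 < f i x} ⊆ A from h₁) hopen
    fun i => lt_of_le_of_ne (h1 i) (h i).symm)

/-- Bounded convex regions whose boundary lies on finitely many lines. -/
structure IsPolygonal (A : Set Plane) : Prop where
  convex : Convex ℝ A
  isBounded : Bornology.IsBounded A
  exists_lines : ∃ a : Fin 3 → Plane, ∃ b : Fin 3 → ℝ, (∀ i, a i ≠ 0) ∧
    ∀ x ∈ frontier A, ∃ i, cross (a i) x = b i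

theorem isPolygonal_of_subset_line {A : Set Plane} (hc : Convex ℝ A) (hb : Bornology.IsBounded A)
    {a : Plane} (ha : a ≠ 0) {b : ℝ} (h : ∀ x ∈ A, cross a x = b) : IsPolygonal A := by
  refine ⟨hc, hb, fun _ => a, fun _ => b, fun _ => ha, fun x hx => ⟨0, ?_⟩⟩
  have hcl : IsClosed {x : Plane | cross a x = b} :=
    isClosed_eq (continuous_cross a) continuous_const
  exact closure_minimal (show A ⊆ {x : Plane | cross a x = b} from h) hcl hx.1

theorem openSimplex_subset_convexHull {k : ℕ} (v : Fin (k + 1) → Plane) :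
    openSimplex v ⊆ convexHull ℝ (range v) := by
  rintro x ⟨w, hw, hs, rfl⟩
  exact (convex_convexHull ℝ _).sum_mem (fun i _ => (hw i).le) hs
    fun i _ => subset_convexHull ℝ _ (mem_range_self i)

theorem convex_openSimplex {k : ℕ} (v : Fin (k + 1) → Plane) : Convex ℝ (openSimplex v) := by
  rintro _ ⟨w, hw, hs, rfl⟩ _ ⟨w', hw', hs', rfl⟩ a b ha hb hab
  refine ⟨fun i => a * w i + b * w' i, fun i => ?_, ?_, ?_⟩
  · rcases ha.eq_or_lt with rfl | ha
    · have : b = 1 := by linarith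
      subst this
      simpa using hw' i
    · have := mul_pos ha (hw i)
      have := mul_nonneg hb (hw' i).le
      linarith
  · rw [Finset.sum_add_distrib, ← Finset.mul_sum, ← Finset.mul_sum, hs, hs']
    linarith
  · simp only [add_smul, Finset.sum_add_distrib, Finset.smul_sum, mul_smul]

theorem isBounded_openSimplex {k : ℕ} (v : Fin (k + 1) → Plane) :
    Bornology.IsBounded (openSimplex v) :=
  (isBounded_convexHull.2 (finite_range v).isBounded).subset (openSimplex_subset_convexHull v)

/-- If the determinant of edge vectors `e`, `f` vanishes, then `f j • e - e j • f = 0` for both `j`;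
independence forces `e = 0`, itself a forbidden relation. -/
theorem cross_ne_zero_of_affineIndependent {v : Fin 3 → Plane} (hv : AffineIndependent ℝ v) :
    cross (v 1 - v 0) (v 2 - v 0) ≠ 0 := by
  intro h
  rw [affineIndependent_iff] at hv
  have key (a b : ℝ) (hab : a • (v 1 - v 0) + b • (v 2 - v 0) = 0) : a = 0 ∧ b = 0 := by
    have := hv Finset.univ ![-a - b, a, b] (by
      simp only [Fin.sum_univ_three, Matrix.cons_val]
      ring) (by
      rw [← hab]
      simp only [Fin.sum_univ_three, Matrix.cons_val]
      module)
    exact ⟨this 1 (Finset.mem_univ _), this 2 (Finset.mem_univ _)⟩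
  simp only [cross] at h
  obtain ⟨h1, h2⟩ := key ((v 2 - v 0) 1) (-(v 1 - v 0) 1) (by
    funext i
    fin_cases i
    · simp only [Pi.add_apply, Pi.smul_apply, smul_eq_mul, Fin.zero_eta, Pi.zero_apply]
      linear_combination h
    · simp only [Pi.add_apply, Pi.smul_apply, smul_eq_mul, Fin.mk_one, Pi.zero_apply]
      ring)
  obtain ⟨h3, h4⟩ := key ((v 2 - v 0) 0) (-(v 1 - v 0) 0) (by
    funext i
    fin_cases i
    · simp only [Pi.add_apply, Pi.smul_apply, smul_eq_mul, Fin.zero_eta, Pi.zero_apply]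
      ring
    · simp only [Pi.add_apply, Pi.smul_apply, smul_eq_mul, Fin.mk_one, Pi.zero_apply]
      linear_combination -h)
  have := key 1 0 (by
    funext i
    fin_cases i
    · simpa using neg_eq_zero.1 h4
    · simpa using neg_eq_zero.1 h2)
  exact one_ne_zero this.1

theorem mem_openTriangle {v : Fin 3 → Plane} {x : Plane} : x ∈ openSimplex (k := 2) v ↔
    ∃ w : Fin 3 → ℝ, (∀ i, 0 < w i) ∧ w 0 + w 1 + w 2 = 1 ∧
      w 0 • v 0 + w 1 • v 1 + w 2 • v 2 = x := by
  have : x ∈ openSimplex (k := 2) v ↔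
    ∃ w : Fin 3 → ℝ, (∀ i, 0 < w i) ∧ ∑ i : Fin 3, w i = 1 ∧ ∑ i : Fin 3, w i • v i = x := Iff.rfl
  simpa only [Fin.sum_univ_three] using this

/-- The normalised cross products with the edges are the barycentric coordinates. -/
theorem isPolygonal_openTriangle {v : Fin 3 → Plane} (hv : AffineIndependent ℝ v) :
    IsPolygonal (openSimplex v) := by
  have hD := cross_ne_zero_of_affineIndependent hv
  refine ⟨convex_openSimplex v, isBounded_openSimplex v, fun i => v (i + 2) - v (i + 1),
    fun i => cross (v (i + 2) - v (i + 1)) (v (i + 1)), ?_, fun x hx => ?_⟩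
  · intro i h
    rw [sub_eq_zero] at h
    have := hv.injective h
    fin_cases i <;> revert this <;> decide
  · have hex := exists_eq_zero_of_mem_frontier (A := openSimplex v) (x := x)
      (f := fun i x => cross (v (i + 2) - v (i + 1)) (x - v (i + 1)) /
        cross (v 1 - v 0) (v 2 - v 0)) ?_ ?_ ?_ hx
    · obtain ⟨i, hi⟩ := hex
      refine ⟨i, ?_⟩
      rw [div_eq_zero_iff, or_iff_left hD] at hi
      simp only [cross, Pi.sub_apply] at hi ⊢
      linear_combination hi
    · exact fun i => by fun_prop
    · refine fun x hx => mem_openTriangle.2 ⟨_, hx, ?_, ?_⟩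
      · rw [← add_div, ← add_div, div_eq_one_iff_eq hD]
        simp only [cross, Pi.sub_apply, Fin.reduceAdd, zero_add]
        ring
      · funext j
        simp only [Pi.add_apply, Pi.smul_apply, smul_eq_mul, div_mul_eq_mul_div]
        rw [← add_div, ← add_div, div_eq_iff hD]
        fin_cases j <;>
        · simp only [cross, Pi.sub_apply, Fin.reduceAdd, zero_add, Fin.zero_eta, Fin.mk_one]
          ring
    · intro x hx i
      obtain ⟨w, hw, hs, rfl⟩ := mem_openTriangle.1 hx
      have : cross (v (i + 2) - v (i + 1)) (w 0 • v 0 + w 1 • v 1 + w 2 • v 2 - v (i + 1)) /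
          cross (v 1 - v 0) (v 2 - v 0) = w i := by
        rw [div_eq_iff hD]
        have h0 : w 0 = 1 - w 1 - w 2 := by linarith
        fin_cases i <;>
        · simp only [cross, Pi.sub_apply, Pi.add_apply, Pi.smul_apply,
            smul_eq_mul, Fin.reduceAdd, zero_add, Fin.zero_eta, Fin.mk_one, Fin.reduceFinMk, h0]
          ring
      rw [this]
      exact (hw i).le

theorem isPolygonal_openSimplex {k : ℕ} {v : Fin (k + 1) → Plane} (hv : AffineIndependent ℝ v) :
    IsPolygonal (openSimplex v) := by
  have hk : k ≤ 2 := by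
    have h1 := hv.card_le_finrank_succ
    have h2 := Submodule.finrank_le (vectorSpan ℝ (range v))
    simp only [Fintype.card_fin, Module.finrank_fin_fun] at h1 h2
    omega
  interval_cases k
  · have h10 : (![1, 0] : Plane) ≠ 0 := fun h => by simpa using congrFun h 0
    refine isPolygonal_of_subset_line (convex_openSimplex v) (isBounded_openSimplex v) h10
      (b := cross ![1, 0] (v 0)) ?_
    rintro x ⟨w, hw, hs, rfl⟩
    have h0 : w 0 = 1 := by simpa using hs
    rw [show ∑ i, w i • v i = w 0 • v 0 from Fin.sum_univ_one _, h0, one_smul]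
  · have hne : v 1 - v 0 ≠ 0 := fun h => by
      have := hv.injective (sub_eq_zero.1 h)
      revert this
      decide
    refine isPolygonal_of_subset_line (convex_openSimplex v) (isBounded_openSimplex v) hne
      (b := cross (v 1 - v 0) (v 0)) ?_
    rintro x ⟨w, hw, hs, rfl⟩
    rw [Fin.sum_univ_two] at hs
    have h0 : w 0 = 1 - w 1 := by linarith
    rw [show ∑ i, w i • v i = w 0 • v 0 + w 1 • v 1 from Fin.sum_univ_two _]
    simp only [cross, Pi.sub_apply, Pi.add_apply, Pi.smul_apply, smul_eq_mul, h0]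
    ring
  · exact isPolygonal_openTriangle hv

/-! ### Primitive directions and finiteness of the jumps -/

/-- Primitive integral vectors. -/
abbrev Primitive : Type := {u : Fin 2 → ℤ // IsCoprime (u 0) (u 1)}

theorem Primitive.ne_zero (u : Primitive) : toPlane u.1 ≠ 0 := toPlane_ne_zero fun h => by
  have := u.2
  rw [h] at this
  simp [isCoprime_zero_left] at this

theorem isCoprime_of_cross {u w : Fin 2 → ℤ} (h : IsUnit (cross u w)) : IsCoprime (u 0) (u 1) := by
  have h' := Int.isUnit_mul_self h
  exact ⟨cross u w * w 1, -(cross u w * w 0), by simp only [cross] at h' ⊢; linear_combination h'⟩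

/-- A Bézout relation for `u` exhibits `w` as an integer multiple of `u`; primitivity of `w` makes
the multiplier a unit. -/
theorem Primitive.eq_or_eq_neg {u w : Primitive} (h : cross u.1 w.1 = 0) :
    w.1 = u.1 ∨ w.1 = -u.1 := by
  obtain ⟨u, a, b, hab⟩ := u
  obtain ⟨w, hw⟩ := w
  simp only [cross] at h ⊢
  set m := a * w 0 + b * w 1 with hm
  have h0 : w 0 = m * u 0 := by rw [hm]; linear_combination (-w 0) * hab - b * h
  have h1 : w 1 = m * u 1 := by rw [hm]; linear_combination (-w 1) * hab + a * h
  have hmu : IsUnit m := hw.isUnit_of_dvd' ⟨_, h0⟩ ⟨_, h1⟩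
  have hwu : w = m • u := by
    funext i
    fin_cases i
    · simpa using h0
    · simpa using h1
  rcases Int.isUnit_iff.1 hmu with h | h
  · left; rw [hwu, h, one_smul]
  · right; rw [hwu, h, neg_one_smul]

/-- A line has at most two primitive directions, `u` and `-u`, and each of them determines the level
of the line. -/
theorem finite_primitive_on_line {a : Plane} (ha : a ≠ 0) (b γ : ℝ) :
    {p : Primitive × ℤ | cross a (toPlane p.1.1) = 0 ∧
      cross a ((γ + p.2) • dual (toPlane p.1.1)) = b}.Finite := by
  set Z := {p : Primitive × ℤ | cross a (toPlane p.1.1) = 0 ∧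
      cross a ((γ + p.2) • dual (toPlane p.1.1)) = b} with hZ
  rcases Z.eq_empty_or_nonempty with h | ⟨⟨u, k⟩, hu⟩
  · rw [h]
    exact finite_empty
  refine Finite.of_finite_image (f := fun p : Primitive × ℤ => p.1.1)
    ((toFinite {u.1, -u.1}).subset ?_) ?_
  · rintro _ ⟨⟨w, l⟩, hw, rfl⟩
    refine Primitive.eq_or_eq_neg ?_
    have h1 := hu.1
    have h2 := hw.1
    have hc : cross (toPlane u.1) (toPlane w.1) = 0 := by
      simp only [cross] at h1 h2 ⊢
      by_contra hne
      refine ha (funext fun i => ?_)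
      fin_cases i
      · refine (mul_eq_zero.1 ?_).resolve_right hne
        simp only [Fin.zero_eta]
        linear_combination (toPlane u.1 0) * h2 - (toPlane w.1 0) * h1
      · refine (mul_eq_zero.1 ?_).resolve_right hne
        simp only [Fin.mk_one]
        linear_combination (toPlane u.1 1) * h2 - (toPlane w.1 1) * h1
    rw [cross_toPlane] at hc
    exact_mod_cast hc
  · rintro ⟨w, k⟩ h ⟨w', l⟩ h' hww
    have hww' : w = w' := Subtype.ext hww
    subst hww'
    have h1 := h.2
    have h2 := h'.2
    have hsm (s : ℝ) : cross a (s • dual (toPlane w.1)) = s * cross a (dual (toPlane w.1)) := by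
      simp only [cross, Pi.smul_apply, smul_eq_mul]; ring
    simp only [hsm] at h1 h2
    have hne : cross a (dual (toPlane w.1)) ≠ 0 := fun h0 => ha <| by
      have := eq_smul_dual_add w.ne_zero a
      rw [h0, show cross (toPlane w.1) a = -cross a (toPlane w.1) by simp only [cross]; ring,
        h.1] at this
      simpa using this
    have := mul_right_cancel₀ hne (h1.trans h2.symm)
    simp only [add_right_inj, Int.cast_inj] at this
    rw [this]

/-- Without this, `∑ᶠ` in `totalJump` could take its default value `0`, and additivity would be
lost. -/
theorem IsPolygonal.finite_support_jump {A : Set Plane} (hA : IsPolygonal A) (γ : ℝ) :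
    (Function.support fun p : Primitive × ℤ => jump A (toPlane p.1.1) (γ + p.2)).Finite := by
  obtain ⟨hc, hb, a, b, ha, hf⟩ := hA
  refine (finite_iUnion fun i => finite_primitive_on_line (ha i) (b i) γ).subset fun p hp => ?_
  obtain ⟨i, hi⟩ := exists_line_of_jump_ne_zero hc hb hf p.1.ne_zero hp
  exact mem_iUnion.2 ⟨i, hi⟩

/-- The sum of the jumps over all oriented rational lines in a class modulo `G`. -/
def totalJump (γ : ℝ) (P : Set Plane) : ℝ :=
  ∑ᶠ p : Primitive × ℤ, jump P (toPlane p.1.1) (γ + p.2)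

theorem totalJump_iUnion (γ : ℝ) {ι : Type*} [Fintype ι] {A : ι → Set Plane}
    (hc : ∀ i, Convex ℝ (A i)) (hb : ∀ i, Bornology.IsBounded (A i))
    (hd : Pairwise fun i j => Disjoint (A i) (A j))
    (hf : ∀ i, (Function.support fun p : Primitive × ℤ =>
      jump (A i) (toPlane p.1.1) (γ + p.2)).Finite) :
    totalJump γ (⋃ i, A i) = ∑ i, totalJump γ (A i) := by
  simp only [totalJump]
  rw [← finsum_sum_comm _ _ fun i _ => hf i]
  exact finsum_congr fun p => jump_iUnion hc hb hd p.1.ne_zero _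

/-! ### Invariance of the total jump under `G` -/

theorem cross_mulVec {R : Type*} [CommRing R] (M : Matrix (Fin 2) (Fin 2) R) (x y : Fin 2 → R) :
    cross (M *ᵥ x) (M *ᵥ y) = M.det * cross x y := by
  simp only [cross, Matrix.mulVec, dotProduct, Fin.sum_univ_two, Matrix.det_fin_two]
  ring

theorem cross_smul_left {R : Type*} [CommRing R] (a : R) (x y : Fin 2 → R) :
    cross (a • x) y = a * cross x y := by
  simp only [cross, Pi.smul_apply, smul_eq_mul]
  ring

theorem det_mul_det (U : GL (Fin 2) ℤ) : U.val.det * U.val.det = 1 :=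
  Int.isUnit_mul_self ((Matrix.isUnit_iff_isUnit_det _).1 U.isUnit)

/-- The action of the group `GL₂(ℤ)` on oriented directions. -/
def twist (U : GL (Fin 2) ℤ) (u : Fin 2 → ℤ) : Fin 2 → ℤ := U.val.det • (U.val *ᵥ u)

theorem twist_inv_twist (U : GL (Fin 2) ℤ) (u : Fin 2 → ℤ) : twist U⁻¹ (twist U u) = u := by
  have h1 := det_mul_det U
  have h2 : (U⁻¹).val * U.val = 1 := by rw [← Units.val_mul, inv_mul_cancel, Units.val_one]
  have h3 : (U⁻¹).val.det * U.val.det = 1 := by rw [← Matrix.det_mul, h2, Matrix.det_one]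
  rw [twist, twist, Matrix.mulVec_smul, Matrix.mulVec_mulVec, h2, Matrix.one_mulVec, smul_smul,
    h3, one_smul]

theorem isCoprime_twist (U : GL (Fin 2) ℤ) {u : Fin 2 → ℤ} (hu : IsCoprime (u 0) (u 1)) :
    IsCoprime (twist U u 0) (twist U u 1) := by
  obtain ⟨a, b, hab⟩ := hu
  refine isCoprime_of_cross (w := U.val *ᵥ ![-b, a]) ?_
  rw [twist, cross_smul_left, cross_mulVec, ← mul_assoc, det_mul_det, one_mul]
  have : cross u ![-b, a] = 1 := by
    simp only [cross, Matrix.cons_val_zero, Matrix.cons_val_one]; linear_combination hab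
  rw [this]
  exact isUnit_one

/-- The permutation of the oriented rational lines in a given class induced by a `G`-map. -/
def lineEquiv (U : GL (Fin 2) ℤ) (v : Fin 2 → ℤ) : Primitive × ℤ ≃ Primitive × ℤ where
  toFun p := (⟨twist U p.1.1, isCoprime_twist U p.1.2⟩, p.2 + cross (twist U p.1.1) v)
  invFun p := (⟨twist U⁻¹ p.1.1, isCoprime_twist U⁻¹ p.1.2⟩, p.2 - cross p.1.1 v)
  left_inv p := by simp [twist_inv_twist]
  right_inv p := by
    have (u : Fin 2 → ℤ) : twist U (twist U⁻¹ u) = u := by simpa using twist_inv_twist U⁻¹ u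
    simp [this]

/-- A `G`-map as an affine map. -/
def gAffine (U : GL (Fin 2) ℤ) (v : Fin 2 → ℤ) : Plane →ᵃ[ℝ] Plane :=
  (Matrix.mulVecLin (U.val.map (Int.cast : ℤ → ℝ))).toAffineMap + AffineMap.const ℝ Plane (toPlane v)

theorem gMap_add (U : GL (Fin 2) ℤ) (v : Fin 2 → ℤ) (x y : Plane) :
    gMap U v (x + y) = gMap U v x + U.val.map (Int.cast : ℤ → ℝ) *ᵥ y := by
  simp only [gMap, Matrix.mulVec_add]
  abel

theorem det_map_intCast (M : Matrix (Fin 2) (Fin 2) ℤ) :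
    (M.map (Int.cast : ℤ → ℝ)).det = (M.det : ℤ) := by
  simp [Matrix.det_fin_two]

theorem gMap_injective (U : GL (Fin 2) ℤ) (v : Fin 2 → ℤ) : Function.Injective (gMap U v) := by
  intro x y h
  have hU : IsUnit (U.val.map (Int.cast : ℤ → ℝ)) := by
    rw [Matrix.isUnit_iff_isUnit_det, det_map_intCast, isUnit_iff_ne_zero]
    exact_mod_cast left_ne_zero_of_mul_eq_one (det_mul_det U)
  exact Matrix.mulVec_injective_of_isUnit hU (add_right_cancel h)

theorem toPlane_twist (U : GL (Fin 2) ℤ) (u : Fin 2 → ℤ) :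
    toPlane (twist U u) = (U.val.det : ℝ) • (U.val.map (Int.cast : ℤ → ℝ) *ᵥ toPlane u) := by
  funext i
  simp only [toPlane, twist, Matrix.mulVec, dotProduct, Fin.sum_univ_two, Pi.smul_apply,
    smul_eq_mul, Matrix.map_apply]
  push_cast
  ring

/-- The determinant in `twist` cancels the one in `cross_mulVec`, so levels are only translated. The
side on which `s` increases is therefore kept even when `U` reverses orientation. -/
theorem chordLength_gMap (U : GL (Fin 2) ℤ) (v : Fin 2 → ℤ) (P : Set Plane) {u : Fin 2 → ℤ}
    (hu : IsCoprime (u 0) (u 1)) (s : ℝ) :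
    chordLength (toPlane (twist U u)) (gMap U v '' P) (s + (cross (twist U u) v : ℤ)) =
      chordLength (toPlane u) P s := by
  have hu0 : toPlane u ≠ 0 := Primitive.ne_zero ⟨u, hu⟩
  have hu1 : toPlane (twist U u) ≠ 0 := Primitive.ne_zero ⟨_, isCoprime_twist U hu⟩
  set x := s • dual (toPlane u)
  have hx : cross (toPlane u) x = s := by simpa using cross_smul_dual_add hu0 s 0
  have hdet : (U.val.det : ℝ) * U.val.det = 1 := by exact_mod_cast det_mul_det U
  have hgx : cross (toPlane (twist U u)) (gMap U v x) = s + (cross (twist U u) v : ℤ) := by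
    have hadd (a b c : Plane) : cross a (b + c) = cross a b + cross a c := by
      simp only [cross, Pi.add_apply]; ring
    rw [gMap, hadd, ← cross_toPlane]
    congr 1
    rw [toPlane_twist, cross_smul_left, cross_mulVec, det_map_intCast, ← mul_assoc, hdet, one_mul,
      hx]
  have hch : chord (gMap U v '' P) (toPlane (twist U u)) (gMap U v x) =
      chord P ((U.val.det : ℝ) • toPlane u) x := by
    ext t
    simp only [chord, mem_ofPred_eq]
    rw [← (gMap_injective U v).mem_set_image (s := P), gMap_add, toPlane_twist,
      Matrix.mulVec_smul, Matrix.mulVec_smul]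
  rw [← hgx, chordLength_eq hu1, hch]
  rcases Int.isUnit_iff.1 ((Matrix.isUnit_iff_isUnit_det _).1 U.isUnit) with h | h
  · rw [h, Int.cast_one, one_smul, ← chordLength_eq hu0, hx]
  · rw [h, Int.cast_neg, Int.cast_one, neg_one_smul, ← chordLength_neg_eq hu0, hx]

theorem jump_gMap (U : GL (Fin 2) ℤ) (v : Fin 2 → ℤ) {P : Set Plane} (hc : Convex ℝ P)
    (hb : Bornology.IsBounded P) {u : Fin 2 → ℤ} (hu : IsCoprime (u 0) (u 1)) (s : ℝ) :
    jump (gMap U v '' P) (toPlane (twist U u)) (s + (cross (twist U u) v : ℤ)) =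
      jump P (toPlane u) s := by
  obtain ⟨l, hl⟩ := exists_tendsto_chordLength hc hb (Primitive.ne_zero ⟨u, hu⟩) s
  have h : Tendsto (chordLength (toPlane (twist U u)) (gMap U v '' P))
      (𝓝[>] (s + (cross (twist U u) v : ℤ))) (𝓝 l) := by
    have : chordLength (toPlane (twist U u)) (gMap U v '' P) =
        chordLength (toPlane u) P ∘ fun r => r - (cross (twist U u) v : ℤ) := by
      funext r
      rw [Function.comp_apply, ← chordLength_gMap U v P hu, sub_add_cancel]
    rw [this]
    refine hl.comp (tendsto_nhdsWithin_iff.2 ⟨?_, ?_⟩)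
    · refine Tendsto.mono_left ?_ nhdsWithin_le_nhds
      exact Continuous.tendsto' (by fun_prop) _ _ (by simp)
    · filter_upwards [self_mem_nhdsWithin] with r hr
      simpa [lt_sub_iff_add_lt] using hr
  rw [jump_eq h, jump_eq hl, chordLength_gMap U v P hu]

/-- Levels move by the integer `cross (twist U u) v`, so the index set is merely permuted. -/
theorem totalJump_gMap (γ : ℝ) (U : GL (Fin 2) ℤ) (v : Fin 2 → ℤ) {P : Set Plane}
    (hc : Convex ℝ P) (hb : Bornology.IsBounded P) :
    totalJump γ (gMap U v '' P) = totalJump γ P := by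
  rw [totalJump, ← finsum_comp_equiv (lineEquiv U v), totalJump]
  refine finsum_congr fun p => ?_
  rw [← jump_gMap U v hc hb p.1.2, add_assoc, ← Int.cast_add]
  rfl

theorem finite_support_jump_gMap (γ : ℝ) (U : GL (Fin 2) ℤ) (v : Fin 2 → ℤ) {P : Set Plane}
    (hP : IsPolygonal P) : (Function.support fun p : Primitive × ℤ =>
      jump (gMap U v '' P) (toPlane p.1.1) (γ + p.2)).Finite := by
  refine Finite.of_preimage ?_ (lineEquiv U v).surjective
  refine (hP.finite_support_jump γ).subset fun p hp => ?_
  rw [mem_preimage, Function.mem_support] at hp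
  rw [Function.mem_support, ← jump_gMap U v hP.convex hP.isBounded p.1.2, add_assoc,
    ← Int.cast_add]
  exact hp

theorem totalJump_eq_of_equidecomposable {P Q : Set Plane}
    (h : FiniteRationalEquidecomposable P Q) (γ : ℝ) : totalJump γ P = totalJump γ Q := by
  obtain ⟨r, A, g, hA, hg, hd, rfl, hd', rfl⟩ := h
  have hA' (i) : IsPolygonal (A i) := by
    obtain ⟨k, v, hv, -, h⟩ := hA i
    exact h ▸ isPolygonal_openSimplex hv
  choose U v hUv using hg
  have hc (i) : Convex ℝ (g i '' A i) := by
    rw [hUv i]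
    exact (hA' i).convex.affine_image (gAffine (U i) (v i))
  have hb (i) : Bornology.IsBounded (g i '' A i) := by
    rw [hUv i]
    have hcont : Continuous (gMap (U i) (v i)) :=
      (gAffine (U i) (v i)).continuous_of_finiteDimensional
    exact ((hA' i).isBounded.isCompact_closure.image hcont).isBounded.subset
      (image_mono subset_closure)
  rw [totalJump_iUnion γ (fun i => (hA' i).convex) (fun i => (hA' i).isBounded) hd
      fun i => (hA' i).finite_support_jump γ,
    totalJump_iUnion γ hc hb hd' fun i => by
      rw [hUv i]
      exact finite_support_jump_gMap γ (U i) (v i) (hA' i)]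
  refine Finset.sum_congr rfl fun i _ => ?_
  rw [hUv i, totalJump_gMap γ (U i) (v i) (hA' i).convex (hA' i).isBounded]

/-! ### Minimal triangles are unimodular after scaling -/

/-- Twice the signed area of a triangle with integral vertices. -/
def area (P : Fin 3 → Fin 2 → ℤ) : ℤ := cross (P 1 - P 0) (P 2 - P 0)

/-- The edges of a triangle with integral vertices, oriented clockwise if the area is `±1/2`. -/
def edge (P : Fin 3 → Fin 2 → ℤ) (i : Fin 3) : Fin 2 → ℤ := area P • (P (i + 1) - P (i + 2))

/-- The barycentric coordinates of the origin if the area is `±1/2`. -/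
def originCoord (P : Fin 3 → Fin 2 → ℤ) (i : Fin 3) : ℤ := area P * cross (P (i + 1)) (P (i + 2))

/-- The points of `T` are the points `P i / d`. -/
def HasVertices (d : ℕ) (T : Affine.Triangle ℝ Plane) (P : Fin 3 → Fin 2 → ℤ) : Prop :=
  ∀ i j, T.points i j = (P i j : ℝ) / d

theorem mem_region_of_weights {T : Affine.Triangle ℝ Plane} {w : Fin 3 → ℝ} (hw : ∀ i, 0 ≤ w i)
    (hs : ∑ i, w i = 1) : ∑ i, w i • T.points i ∈ region T :=
  (convex_convexHull ℝ _).sum_mem (fun i _ => hw i) hs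
    fun i _ => subset_convexHull ℝ _ (mem_range_self i)

theorem HasVertices.area_ne_zero {d : ℕ} (hd : 0 < d) {T : Affine.Triangle ℝ Plane}
    {P : Fin 3 → Fin 2 → ℤ} (h : HasVertices d T P) : area P ≠ 0 := by
  have hd' : (d : ℝ) ≠ 0 := by exact_mod_cast hd.ne'
  intro h0
  refine cross_ne_zero_of_affineIndependent T.independent ?_
  have h0' : ((area P : ℤ) : ℝ) = 0 := by rw [h0, Int.cast_zero]
  simp only [area, cross, Pi.sub_apply] at h0'
  push_cast at h0'
  simp only [cross, Pi.sub_apply, h _ _]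
  field_simp
  linear_combination h0'

/-- After division by `d`, `P 0 + y` is a lattice point with nonnegative barycentric coordinates,
hence a vertex; independence of the edge vectors then determines `A` and `B`. -/
theorem eq_vertex_of_minimal {d : ℕ} (hd : 0 < d) {T : Affine.Triangle ℝ Plane}
    (hT : IsMinimal d T) {P : Fin 3 → Fin 2 → ℤ} (hP : HasVertices d T P) {N A B : ℤ} (hN : 0 < N)
    (hA : 0 ≤ A) (hB : 0 ≤ B) (hAB : A + B ≤ N) {y : Fin 2 → ℤ}
    (hy : N • y = A • (P 1 - P 0) + B • (P 2 - P 0)) :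
    (A = 0 ∧ B = 0) ∨ (A = N ∧ B = 0) ∨ (A = 0 ∧ B = N) := by
  have hd' : (d : ℝ) ≠ 0 := by exact_mod_cast hd.ne'
  have hN' : (0 : ℝ) < N := by exact_mod_cast hN
  have hNAB : (0 : ℝ) ≤ N - A - B := by
    have : (A + B : ℝ) ≤ N := by exact_mod_cast hAB
    linarith
  have hmem := mem_region_of_weights (T := T)
    (w := ![((N : ℝ) - A - B) / N, (A : ℝ) / N, (B : ℝ) / N])
    (by
      intro i
      fin_cases i
      · exact div_nonneg hNAB hN'.le
      · exact div_nonneg (by exact_mod_cast hA) hN'.le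
      · exact div_nonneg (by exact_mod_cast hB) hN'.le)
    (by
      simp only [Fin.sum_univ_three, Matrix.cons_val]
      field_simp
      ring)
  set x := ∑ i, ![((N : ℝ) - A - B) / N, (A : ℝ) / N, (B : ℝ) / N] i • T.points i with hx
  have hxj (j : Fin 2) : x j = ((P 0 + y) j : ℤ) / d := by
    have hyj := congrArg (Int.cast : ℤ → ℝ) (congrFun hy j)
    simp only [Pi.smul_apply, Pi.add_apply, Pi.sub_apply, smul_eq_mul] at hyj
    push_cast at hyj
    simp only [hx, Fin.sum_univ_three, Matrix.cons_val, Pi.add_apply, Pi.smul_apply, smul_eq_mul,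
      hP _ _]
    push_cast
    field_simp
    linear_combination -hyj
  have hv : x ∈ range T.points := by
    have hT' : region T ∩ lattice d = range T.points := hT
    rw [← hT']
    exact ⟨hmem, P 0 + y, hxj⟩
  obtain ⟨i, hi⟩ := hv
  have hPi : y = P i - P 0 := by
    funext j
    have h1 := hxj j
    rw [← hi, hP i j, div_left_inj' hd', Int.cast_inj] at h1
    simp only [Pi.add_apply, Pi.sub_apply] at h1 ⊢
    linarith
  have hD := hP.area_ne_zero hd
  rw [hPi] at hy
  have h0 := congrFun hy 0
  have h1 := congrFun hy 1
  simp only [Pi.smul_apply, Pi.add_apply, Pi.sub_apply, smul_eq_mul] at h0 h1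
  have key (a b : ℤ) (h0 : a * (P 1 0 - P 0 0) + b * (P 2 0 - P 0 0) = 0)
      (h1 : a * (P 1 1 - P 0 1) + b * (P 2 1 - P 0 1) = 0) : a = 0 ∧ b = 0 := by
    constructor
    · refine (mul_eq_zero.1 (?_ : a * area P = 0)).resolve_right hD
      simp only [area, cross, Pi.sub_apply]
      linear_combination (P 2 1 - P 0 1) * h0 - (P 2 0 - P 0 0) * h1
    · refine (mul_eq_zero.1 (?_ : b * area P = 0)).resolve_right hD
      simp only [area, cross, Pi.sub_apply]
      linear_combination (P 1 0 - P 0 0) * h1 - (P 1 1 - P 0 1) * h0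
  fin_cases i
  · simp only [Fin.zero_eta] at h0 h1
    exact Or.inl (key A B (by linear_combination -h0) (by linear_combination -h1))
  · simp only [Fin.mk_one] at h0 h1
    obtain ⟨ha, hb⟩ := key (A - N) B (by linear_combination -h0) (by linear_combination -h1)
    exact Or.inr (Or.inl ⟨by linarith, hb⟩)
  · simp only [Fin.reduceFinMk] at h0 h1
    obtain ⟨ha, hb⟩ := key A (B - N) (by linear_combination -h0) (by linear_combination -h1)
    exact Or.inr (Or.inr ⟨ha, by linarith⟩)

theorem eq_zero_of_minimal {d : ℕ} (hd : 0 < d) {T : Affine.Triangle ℝ Plane}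
    (hT : IsMinimal d T) {P : Fin 3 → Fin 2 → ℤ} (hP : HasVertices d T P) {N A B : ℤ}
    (hA : 0 ≤ A) (hB : 0 ≤ B) (hAN : A < N) (hBN : B < N) {y : Fin 2 → ℤ}
    (hy : N • y = A • (P 1 - P 0) + B • (P 2 - P 0)) : A = 0 ∧ B = 0 := by
  by_cases hAB : A + B ≤ N
  · have := eq_vertex_of_minimal hd hT hP (by linarith) hA hB hAB hy
    omega
  -- Beyond the diagonal, reflect in the centre of the parallelogram spanned by the two edges.
  · have := eq_vertex_of_minimal hd hT hP (N := N) (A := N - A) (B := N - B)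
      (y := (P 1 - P 0) + (P 2 - P 0) - y) (by omega) (by omega) (by omega) (by omega)
      (by rw [smul_sub, hy]; module)
    omega

/-- Cramer's rule writes `area P • z` in the edge vectors. Reducing the coefficients modulo `|area
P|` leaves a lattice point of the half-open parallelogram, which must be the origin. -/
theorem area_dvd_of_minimal {d : ℕ} (hd : 0 < d) {T : Affine.Triangle ℝ Plane}
    (hT : IsMinimal d T) {P : Fin 3 → Fin 2 → ℤ} (hP : HasVertices d T P) (z : Fin 2 → ℤ) :
    area P ∣ cross z (P 2 - P 0) ∧ area P ∣ cross (P 1 - P 0) z := by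
  have hD := hP.area_ne_zero hd
  set A := cross z (P 2 - P 0) with hA
  set B := cross (P 1 - P 0) z with hB
  have hN : 0 < |area P| := abs_pos.2 hD
  have hz : |area P| • ((area P).sign • z) = A • (P 1 - P 0) + B • (P 2 - P 0) := by
    rw [smul_smul, mul_comm, Int.sign_mul_abs]
    funext j
    simp only [area, hA, hB]
    fin_cases j <;>
    · simp only [cross, Pi.smul_apply, Pi.add_apply, Pi.sub_apply, smul_eq_mul, Fin.zero_eta,
        Fin.mk_one]
      ring
  have := eq_zero_of_minimal hd hT hP (N := |area P|) (A := A % |area P|) (B := B % |area P|)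
    (y := (area P).sign • z - (A / |area P|) • (P 1 - P 0) - (B / |area P|) • (P 2 - P 0))
    (Int.emod_nonneg _ hN.ne') (Int.emod_nonneg _ hN.ne') (Int.emod_lt_of_pos _ hN)
    (Int.emod_lt_of_pos _ hN) (by
      rw [smul_sub, smul_sub, hz, Int.emod_def, Int.emod_def]
      module)
  exact ⟨(abs_dvd _ _).1 (Int.dvd_of_emod_eq_zero this.1),
    (abs_dvd _ _).1 (Int.dvd_of_emod_eq_zero this.2)⟩

theorem exists_vertices_of_minimal {d : ℕ} (hd : 0 < d) {T : Affine.Triangle ℝ Plane}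
    (hT : IsMinimal d T) : ∃ P, HasVertices d T P ∧ area P * area P = 1 := by
  have hT' : region T ∩ lattice d = range T.points := hT
  have h (i) : T.points i ∈ lattice d := (hT'.ge (mem_range_self i)).2
  choose P hP using h
  have hP' : HasVertices d T P := hP
  refine ⟨P, hP', Int.isUnit_mul_self ?_⟩
  obtain ⟨a, ha⟩ := (area_dvd_of_minimal hd hT hP' ![1, 0]).1
  obtain ⟨b, hb⟩ := (area_dvd_of_minimal hd hT hP' ![0, 1]).1
  obtain ⟨a', ha'⟩ := (area_dvd_of_minimal hd hT hP' ![1, 0]).2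
  obtain ⟨b', hb'⟩ := (area_dvd_of_minimal hd hT hP' ![0, 1]).2
  -- The area divides all four coordinates of the two edge vectors, so its square divides their
  -- determinant, which is the area itself.
  refine IsUnit.of_mul_eq_one (a * b' - b * a')
    (mul_left_cancel₀ (hP'.area_ne_zero hd) ?_)
  have hdef : area P = cross (P 1 - P 0) (P 2 - P 0) := rfl
  simp only [cross, Matrix.cons_val_zero, Matrix.cons_val_one, Pi.sub_apply] at ha hb ha' hb' hdef
  linear_combination (-b' * area P) * ha + (a' * area P) * hb -
    (P 2 1 - P 0 1) * hb' - (P 2 0 - P 0 0) * ha' - hdef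

/-! ### Edges and barycentric coordinates -/

theorem fin_three_cases (i j : Fin 3) : j = i ∨ j = i + 1 ∨ j = i + 2 := by
  revert i j
  decide

theorem edge_add_two (P : Fin 3 → Fin 2 → ℤ) (i : Fin 3) :
    edge P (i + 2) = -edge P i - edge P (i + 1) := by
  fin_cases i <;>
  · simp only [edge, Fin.zero_eta, Fin.mk_one, Fin.reduceFinMk, Fin.reduceAdd, zero_add]
    module

theorem cross_edge (P : Fin 3 → Fin 2 → ℤ) (h : area P * area P = 1) (i : Fin 3) :
    cross (edge P i) (edge P (i + 1)) = area P := by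
  have : cross (edge P i) (edge P (i + 1)) = area P * area P * area P := by
    conv_rhs => rw [area.eq_def]
    fin_cases i <;>
    · simp only [edge, cross, Fin.zero_eta, Fin.mk_one, Fin.reduceFinMk, Fin.reduceAdd, zero_add,
        Pi.smul_apply, Pi.sub_apply, smul_eq_mul, area]
      ring
  rw [this, h, one_mul]

theorem originCoord_add (P : Fin 3 → Fin 2 → ℤ) (h : area P * area P = 1) (i : Fin 3) :
    originCoord P i + originCoord P (i + 1) + originCoord P (i + 2) = 1 := by
  rw [← h]
  simp only [originCoord]
  fin_cases i <;>
  · simp only [← mul_add, Fin.zero_eta, Fin.mk_one, Fin.reduceFinMk, Fin.reduceAdd, zero_add]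
    congr 1
    simp only [cross, area, Pi.sub_apply]
    ring

theorem sum_originCoord_smul (P : Fin 3 → Fin 2 → ℤ) : ∑ i, originCoord P i • P i = 0 := by
  funext j
  simp only [originCoord, Fin.sum_univ_three, mul_smul, ← smul_add, Pi.smul_apply, Pi.zero_apply,
    smul_eq_zero]
  right
  fin_cases j <;>
  · simp only [cross, Fin.zero_eta, Fin.mk_one, Fin.reduceAdd, zero_add, Pi.add_apply,
      Pi.smul_apply, smul_eq_mul]
    ring

theorem edge_isCoprime {P : Fin 3 → Fin 2 → ℤ} (h : area P * area P = 1) (i : Fin 3) :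
    IsCoprime (edge P i 0) (edge P i 1) :=
  isCoprime_of_cross (w := edge P (i + 1)) (cross_edge P h i ▸ IsUnit.of_mul_eq_one _ h)

theorem cross_edge_ne_zero {P : Fin 3 → Fin 2 → ℤ} (h : area P * area P = 1) {i j : Fin 3}
    (hij : j ≠ i) : cross (edge P i) (edge P j) ≠ 0 := by
  have h0 : area P ≠ 0 := left_ne_zero_of_mul_eq_one h
  have h1 := cross_edge P h i
  rcases fin_three_cases i j with rfl | rfl | rfl
  · exact absurd rfl hij
  · rwa [h1]
  · rw [edge_add_two]
    simp only [cross, Pi.sub_apply, Pi.neg_apply] at h1 ⊢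
    intro h2
    exact h0 (by linear_combination -h2 - h1)

/-- The affine function indexed by `i` is the barycentric coordinate: it is `1` at vertex `i` and
`0` at the other two vertices. -/
theorem region_eq {d : ℕ} (hd : 0 < d) {T : Affine.Triangle ℝ Plane} {P : Fin 3 → Fin 2 → ℤ}
    (hP : HasVertices d T P) (h : area P * area P = 1) :
    region T = {x | ∀ i, 0 ≤ originCoord P i - d * cross (toPlane (edge P i)) x} := by
  have hd' : (d : ℝ) ≠ 0 := by exact_mod_cast hd.ne'
  have h' : (area P * area P : ℝ) = 1 := by exact_mod_cast h
  have harea : (area P : ℝ) = cross (toPlane (P 1 - P 0)) (toPlane (P 2 - P 0)) := by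
    rw [cross_toPlane]; rfl
  refine Subset.antisymm (convexHull_min ?_ ?_) ?_
  · rintro _ ⟨i, rfl⟩ j
    have : (originCoord P j - d * cross (toPlane (edge P j)) (T.points i) : ℝ) =
        if i = j then 1 else 0 := by
      have h2 : (originCoord P j - d * cross (toPlane (edge P j)) (T.points i) : ℝ) =
          if i = j then (area P * area P : ℝ) else 0 := by
        have : (originCoord P j - d * cross (toPlane (edge P j)) (T.points i) : ℝ) =
            area P * if i = j then cross (toPlane (P 1 - P 0)) (toPlane (P 2 - P 0)) else 0 := by
          simp only [originCoord, edge, cross, toPlane, Pi.smul_apply, Pi.sub_apply, smul_eq_mul,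
            hP _ _]
          push_cast
          fin_cases i <;> fin_cases j <;>
          · simp
            field_simp
            ring
        rw [this, ← harea]
        split_ifs <;> simp
      rw [h2, h']
    rw [this]
    split_ifs <;> norm_num
  · intro x hx y hy a b ha hb hab i
    have h1 := mul_nonneg ha (hx i)
    have h2 := mul_nonneg hb (hy i)
    refine (add_nonneg h1 h2).trans_eq ?_
    simp only [cross, Pi.add_apply, Pi.smul_apply, smul_eq_mul]
    linear_combination (originCoord P i : ℝ) * hab
  · intro x hx
    have hsum : ∑ i : Fin 3, (originCoord P i - d * cross (toPlane (edge P i)) x) = 1 := by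
      have h1 : (originCoord P 0 + originCoord P 1 + originCoord P 2 : ℝ) = 1 := by
        exact_mod_cast originCoord_add P h 0
      simp only [Fin.sum_univ_three]
      have h2 : cross (toPlane (edge P 0)) x + cross (toPlane (edge P 1)) x +
          cross (toPlane (edge P 2)) x = 0 := by
        simp only [edge, cross, toPlane, Fin.reduceAdd, zero_add, Pi.smul_apply, Pi.sub_apply,
          smul_eq_mul]
        push_cast
        ring
      linear_combination h1 - d * h2
    convert mem_region_of_weights (T := T) hx hsum using 1
    have h0 : ∑ i : Fin 3, (originCoord P i : ℝ) • T.points i = 0 := by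
      funext j
      have := congrArg (Int.cast : ℤ → ℝ) (congrFun (sum_originCoord_smul P) j)
      simp only [Finset.sum_apply, Pi.smul_apply, smul_eq_mul, hP _ _, Pi.zero_apply] at this ⊢
      push_cast at this
      simp only [← mul_div_assoc, ← Finset.sum_div, this, zero_div]
    simp only [sub_smul, Finset.sum_sub_distrib, h0, zero_sub]
    funext j
    rw [← one_mul (x j), ← h']
    nth_rewrite 2 [harea]
    simp only [Fin.sum_univ_three, edge, cross, toPlane, Fin.reduceAdd, zero_add, Pi.smul_apply,
      Pi.sub_apply, Pi.neg_apply, Pi.add_apply, smul_eq_mul, hP _ _]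
    push_cast
    field_simp
    fin_cases j <;> simp only [Fin.zero_eta, Fin.mk_one] <;> ring

theorem convex_bounded_frontier_region {d : ℕ} (hd : 0 < d) {T : Affine.Triangle ℝ Plane}
    {P : Fin 3 → Fin 2 → ℤ} (hP : HasVertices d T P) (h : area P * area P = 1) :
    Convex ℝ (region T) ∧ Bornology.IsBounded (region T) ∧
      ∀ x ∈ frontier (region T), ∃ i, cross (toPlane (edge P i)) x = originCoord P i / d := by
  have hd' : (d : ℝ) ≠ 0 := by exact_mod_cast hd.ne'
  refine ⟨convex_convexHull ℝ _, isBounded_convexHull.2 (finite_range _).isBounded, fun x hx => ?_⟩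
  have hex := exists_eq_zero_of_mem_frontier (A := region T) (x := x)
    (f := fun i x => originCoord P i - d * cross (toPlane (edge P i)) x)
    (fun i => by fun_prop) ?_ ?_ hx
  · obtain ⟨i, hi⟩ := hex
    exact ⟨i, by field_simp; linear_combination -hi⟩
  · rw [region_eq hd hP h]
    exact fun x hx i => (hx i).le
  · rw [region_eq hd hP h]
    exact fun x hx => hx

/-! ### The jumps of a minimal triangle -/

/-- Chords parallel to an edge grow linearly from `0` at the opposite vertex to `1/d` at the edge,
and are empty beyond it. -/
theorem chordLength_region {d : ℕ} (hd : 0 < d) {T : Affine.Triangle ℝ Plane}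
    {P : Fin 3 → Fin 2 → ℤ} (hP : HasVertices d T P) (h : area P * area P = 1) (i : Fin 3) (s : ℝ) :
    chordLength (toPlane (edge P i)) (region T) s =
      if s ≤ originCoord P i / d then max ((1 - originCoord P i) / d + s) 0 else 0 := by
  have hd' : (0 : ℝ) < d := by exact_mod_cast hd
  have h' : (area P * area P : ℝ) = 1 := by exact_mod_cast h
  have hu := Primitive.ne_zero ⟨_, edge_isCoprime h i⟩
  have hc : cross (toPlane (edge P i)) (toPlane (edge P (i + 1))) = area P := by
    rw [cross_toPlane, cross_edge P h]
  have hc' : cross (toPlane (edge P (i + 1))) (toPlane (edge P i)) = -area P := by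
    rw [← hc]; simp only [cross]; ring
  have he : toPlane (edge P (i + 2)) = -toPlane (edge P i) - toPlane (edge P (i + 1)) := by
    rw [edge_add_two]
    funext j
    simp [toPlane]
  have hself (u : Plane) : cross u u = 0 := by simp only [cross]; ring
  have hlin (u x y : Plane) (a t b : ℝ) : cross u (a • x + t • b • y) =
      a * cross u x + t * b * cross u y := by
    simp only [cross, Pi.add_apply, Pi.smul_apply, smul_eq_mul]; ring
  have hlin' (u w x : Plane) : cross (-u - w) x = -cross u x - cross w x := by
    simp only [cross, Pi.sub_apply, Pi.neg_apply]; ring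
  have hs : (1 - originCoord P i : ℝ) = originCoord P (i + 1) + originCoord P (i + 2) := by
    have : (originCoord P i + originCoord P (i + 1) + originCoord P (i + 2) : ℝ) = 1 := by
      exact_mod_cast originCoord_add P h i
    linarith
  -- A point of level `s` on which, by `cross_edge`, the other two edge inequalities become a lower
  -- and an upper bound for `t`.
  set x := (s * area P) • toPlane (edge P (i + 1)) with hx
  have hux : cross (toPlane (edge P i)) x = s := by
    have := hlin (toPlane (edge P i)) (toPlane (edge P (i + 1))) 0 (s * area P) 0 0
    simp only [smul_zero, add_zero, zero_mul, hc] at this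
    rw [hx, this, mul_assoc, h', mul_one]
  have hsign : chordLength (toPlane (edge P i)) (region T) s =
      volume.real (chord (region T) ((area P : ℝ) • toPlane (edge P i)) x) := by
    rw [← hux]
    rcases Int.isUnit_iff.1 (IsUnit.of_mul_eq_one _ h) with h1 | h1
    · rw [h1, Int.cast_one, one_smul, chordLength_eq hu]
    · rw [h1, Int.cast_neg, Int.cast_one, neg_one_smul, chordLength_neg_eq hu]
  have hch : chord (region T) ((area P : ℝ) • toPlane (edge P i)) x =
      {t : ℝ | s ≤ originCoord P i / d ∧ -(originCoord P (i + 1) / d : ℝ) ≤ t ∧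
        t ≤ originCoord P (i + 2) / d + s} := by
    ext t
    have e0 : cross (toPlane (edge P i)) (x + t • (area P : ℝ) • toPlane (edge P i)) = s := by
      rw [hx, hlin, hc, hself]; linear_combination s * h'
    have e1 : cross (toPlane (edge P (i + 1))) (x + t • (area P : ℝ) • toPlane (edge P i)) =
        -t := by
      rw [hx, hlin, hc', hself]; linear_combination -t * h'
    have e2 : cross (toPlane (edge P (i + 2))) (x + t • (area P : ℝ) • toPlane (edge P i)) =
        t - s := by
      rw [he, hlin', e0, e1]; ring
    have h0 : s ≤ originCoord P i / d ↔ 0 ≤ originCoord P i - d * s := by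
      rw [le_div_iff₀' hd', sub_nonneg]
    have h1 : -(originCoord P (i + 1) / d : ℝ) ≤ t ↔ 0 ≤ originCoord P (i + 1) - d * (-t) := by
      rw [neg_le, le_div_iff₀' hd', sub_nonneg]
    have h2 : t ≤ originCoord P (i + 2) / d + s ↔ 0 ≤ originCoord P (i + 2) - d * (t - s) := by
      rw [← sub_le_iff_le_add, le_div_iff₀' hd', sub_nonneg]
    rw [mem_ofPred_eq, h0, h1, h2, chord, mem_ofPred_eq, region_eq hd hP h,
      mem_ofPred_eq]
    refine ⟨fun h => ⟨?_, ?_, ?_⟩, fun ⟨h0, h1, h2⟩ j => ?_⟩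
    · have := h i; rwa [e0] at this
    · have := h (i + 1); rwa [e1] at this
    · have := h (i + 2); rwa [e2] at this
    · rcases fin_three_cases i j with rfl | rfl | rfl
      · rwa [e0]
      · rwa [e1]
      · rwa [e2]
  rw [hsign, hch]
  split_ifs with hle
  · have : {t : ℝ | s ≤ originCoord P i / d ∧ -(originCoord P (i + 1) / d : ℝ) ≤ t ∧
        t ≤ originCoord P (i + 2) / d + s} =
        Icc (-(originCoord P (i + 1) / d : ℝ)) (originCoord P (i + 2) / d + s) := by
      ext t; simp [hle]
    rw [this, Real.volume_real_Icc, hs]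
    congr 1
    ring
  · simp [hle]

theorem jump_region_edge {d : ℕ} (hd : 0 < d) {T : Affine.Triangle ℝ Plane}
    {P : Fin 3 → Fin 2 → ℤ} (hP : HasVertices d T P) (h : area P * area P = 1) (i : Fin 3) :
    jump (region T) (toPlane (edge P i)) (originCoord P i / d) = -(1 / d) := by
  have hd' : (0 : ℝ) < d := by exact_mod_cast hd
  have hlim : Tendsto (chordLength (toPlane (edge P i)) (region T))
      (𝓝[>] (originCoord P i / d)) (𝓝 0) := by
    refine tendsto_const_nhds.congr' ?_
    filter_upwards [self_mem_nhdsWithin] with s hs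
    rw [chordLength_region hd hP h, if_neg (not_le.2 hs)]
  rw [jump_eq hlim, chordLength_region hd hP h, if_pos le_rfl, ← add_div, sub_add_cancel,
    max_eq_left (by positivity), zero_sub]

/-- With reversed orientation the right-hand side is the inside, and the triangle contains its edge,
so the length is right continuous. Each edge is thus counted once. -/
theorem jump_region_neg_edge {d : ℕ} (hd : 0 < d) {T : Affine.Triangle ℝ Plane}
    {P : Fin 3 → Fin 2 → ℤ} (hP : HasVertices d T P) (h : area P * area P = 1) (i : Fin 3) :
    jump (region T) (-toPlane (edge P i)) (-(originCoord P i / d)) = 0 := by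
  have hd' : (0 : ℝ) < d := by exact_mod_cast hd
  have hu := Primitive.ne_zero ⟨_, edge_isCoprime h i⟩
  have hval (s : ℝ) : chordLength (-toPlane (edge P i)) (region T) s =
      if -s ≤ originCoord P i / d then max ((1 - originCoord P i) / d + -s) 0 else 0 := by
    rw [← chordLength_region hd hP h, ← chordLength_neg hu, neg_neg]
  have hlim : Tendsto (chordLength (-toPlane (edge P i)) (region T))
      (𝓝[>] (-(originCoord P i / d))) (𝓝 (1 / d)) := by
    have h1 : Tendsto (fun s : ℝ => max ((1 - originCoord P i) / d + -s) 0)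
        (𝓝[>] (-(originCoord P i / d))) (𝓝 (1 / d)) := by
      refine Tendsto.mono_left (Continuous.tendsto' (by fun_prop) _ _ ?_) nhdsWithin_le_nhds
      rw [neg_neg, ← add_div, sub_add_cancel, max_eq_left (by positivity)]
    refine h1.congr' ?_
    filter_upwards [self_mem_nhdsWithin] with s hs
    rw [hval, if_pos (neg_le.1 (le_of_lt hs))]
  rw [jump_eq hlim, hval, neg_neg, if_pos le_rfl, ← add_div, sub_add_cancel,
    max_eq_left (by positivity), sub_self]

open Classical in
theorem jump_region {d : ℕ} (hd : 0 < d) {T : Affine.Triangle ℝ Plane} {P : Fin 3 → Fin 2 → ℤ}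
    (hP : HasVertices d T P) (h : area P * area P = 1) (u : Primitive) (c : ℝ) :
    jump (region T) (toPlane u.1) c =
      ∑ i, if u.1 = edge P i ∧ c = originCoord P i / d then -(1 / d : ℝ) else 0 := by
  by_cases hi : ∃ i, u.1 = edge P i ∧ c = originCoord P i / d
  · obtain ⟨i, hu, rfl⟩ := hi
    rw [hu, jump_region_edge hd hP h, Finset.sum_eq_single i]
    · simp
    · intro j _ hj
      -- Distinct edges are not parallel, so no second index contributes.
      refine if_neg fun h' => cross_edge_ne_zero h hj ?_
      rw [← h'.1]
      simp only [cross]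
      ring
    · simp
  rw [Finset.sum_eq_zero fun i _ => if_neg fun h' => hi ⟨i, h'⟩]
  by_contra hne
  obtain ⟨hc, hb, hf⟩ := convex_bounded_frontier_region hd hP h
  obtain ⟨i, h1, h2⟩ := exists_line_of_jump_ne_zero hc hb hf u.ne_zero hne
  rw [cross_toPlane, Int.cast_eq_zero] at h1
  have hcd : cross (toPlane u.1) (c • dual (toPlane u.1)) = c := by
    simpa using cross_smul_dual_add u.ne_zero c 0
  rcases Primitive.eq_or_eq_neg (u := ⟨_, edge_isCoprime h i⟩) h1 with h3 | h3
  · simp only at h3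
    rw [← h3, hcd] at h2
    exact hi ⟨i, h3, h2⟩
  · simp only at h3
    have h4 : toPlane u.1 = -toPlane (edge P i) := by
      rw [h3]; funext j; simp [toPlane]
    have hneg (y : Plane) : cross (toPlane u.1) y = -cross (toPlane (edge P i)) y := by
      rw [h4]
      simp only [cross, Pi.neg_apply]
      ring
    have h5 : c = -(originCoord P i / d) := by
      rw [← h2, ← hneg, hcd]
    rw [h4, h5] at hne
    exact hne (jump_region_neg_edge hd hP h i)

open Classical in
-- Edge `i` contributes exactly when `originCoord P i = a + d * k` for some integer `k`, and then
-- for that `k` alone.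
theorem totalJump_region {d : ℕ} (hd : 0 < d) {T : Affine.Triangle ℝ Plane}
    {P : Fin 3 → Fin 2 → ℤ} (hP : HasVertices d T P) (h : area P * area P = 1) (a : ℤ) :
    totalJump (a / d) (region T) =
      ∑ i, if (originCoord P i : ZMod d) = a then -(1 / d : ℝ) else 0 := by
  have hd' : (d : ℝ) ≠ 0 := by exact_mod_cast hd.ne'
  have hsupp (i : Fin 3) (p : Primitive × ℤ) : (p.1.1 = edge P i ∧
      (a / d + p.2 : ℝ) = originCoord P i / d) ↔
      p.1.1 = edge P i ∧ originCoord P i = a + d * p.2 := by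
    refine and_congr_right fun _ => ?_
    rw [div_add' _ _ _ hd', div_left_inj' hd', eq_comm, mul_comm]
    exact_mod_cast Iff.rfl
  simp only [totalJump, jump_region hd hP h, hsupp]
  have hfin (i : Fin 3) : ((fun p : Primitive × ℤ =>
      if p.1.1 = edge P i ∧ originCoord P i = a + d * p.2 then -(1 / d : ℝ) else 0).support) ⊆
      {(⟨edge P i, edge_isCoprime h i⟩, (originCoord P i - a) / d)} := by
    intro p hp
    rw [Function.mem_support, Ne, ite_eq_right_iff, Classical.not_imp] at hp
    obtain ⟨⟨h1, h2⟩, -⟩ := hp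
    have hdz : (d : ℤ) ≠ 0 := by exact_mod_cast hd.ne'
    refine Prod.ext (Subtype.ext h1) ?_
    simp [h2, Int.mul_ediv_cancel_left _ hdz]
  rw [finsum_sum_comm _ _ fun i _ => (finite_singleton _).subset (hfin i)]
  refine Finset.sum_congr rfl fun i _ => ?_
  split_ifs with hi
  · rw [eq_comm, ZMod.intCast_eq_intCast_iff_dvd_sub] at hi
    obtain ⟨k, hk⟩ := hi
    rw [finsum_eq_single _ (⟨edge P i, edge_isCoprime h i⟩, k)]
    · rw [if_pos ⟨rfl, by linarith⟩]
    · rintro ⟨u, l⟩ hne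
      refine if_neg fun h' => hne ?_
      have hdz : (d : ℤ) ≠ 0 := by exact_mod_cast hd.ne'
      refine Prod.ext (Subtype.ext h'.1) (mul_left_cancel₀ hdz ?_)
      linarith [h'.2]
  · refine (finsum_congr fun p => if_neg fun h' => hi ?_).trans finsum_zero
    rw [h'.2]
    simp

/-! ### Weights as barycentric coordinates of the origin -/

theorem edgeWeight_eq {d : ℕ} (hd : 0 < d) {T : Affine.Triangle ℝ Plane} {P : Fin 3 → Fin 2 → ℤ}
    (hP : HasVertices d T P) (i j : Fin 3) :
    edgeWeight d (T.points i) (T.points j) = (cross (P i) (P j) : ℤ) := by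
  rw [edgeWeight, coord_eq hd (hP i), coord_eq hd (hP j), Matrix.det_fin_two_of, cross]
  congr 1
  ring

theorem isCounterclockwise_iff {d : ℕ} (hd : 0 < d) {T : Affine.Triangle ℝ Plane}
    {P : Fin 3 → Fin 2 → ℤ} (hP : HasVertices d T P) :
    IsCounterclockwise (T.points 0) (T.points 1) (T.points 2) ↔ 0 < area P := by
  have hd' : (0 : ℝ) < d := by exact_mod_cast hd
  have : !![T.points 1 0 - T.points 0 0, T.points 2 0 - T.points 0 0;
      T.points 1 1 - T.points 0 1, T.points 2 1 - T.points 0 1].det = (area P : ℝ) / d ^ 2 := by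
    rw [Matrix.det_fin_two_of, area, cross]
    simp only [hP _ _, Pi.sub_apply]
    push_cast
    field_simp
  rw [IsCounterclockwise, this, div_pos_iff_of_pos_right (by positivity), Int.cast_pos]

/-- The factor `area P = ±1` in `originCoord` accounts for the reversal of a clockwise labelling. -/
theorem weight_eq {d : ℕ} (hd : 0 < d) {T : Affine.Triangle ℝ Plane} {P : Fin 3 → Fin 2 → ℤ}
    (hP : HasVertices d T P) (h : area P * area P = 1) :
    weight d T = Finset.univ.val.map fun i => (originCoord P i : ZMod d) := by
  have huniv (f : Fin 3 → ZMod d) : Finset.univ.val.map f = {f 0, f 1, f 2} := rfl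
  have hanti (i j : Fin 3) : cross (P i) (P j) = -cross (P j) (P i) := by
    simp only [cross]; ring
  rw [weight, huniv]
  simp only [edgeWeight_eq hd hP, isCounterclockwise_iff hd hP, originCoord, Fin.reduceAdd,
    zero_add, Multiset.insert_eq_cons]
  rcases Int.isUnit_iff.1 (IsUnit.of_mul_eq_one _ h) with h1 | h1
  · rw [h1, if_pos one_pos]
    simp only [one_mul]
    rw [Multiset.cons_swap, ← Multiset.singleton_add, ← Multiset.singleton_add,
      ← Multiset.singleton_add, ← Multiset.singleton_add]
    abel
  · rw [h1, if_neg (by norm_num), hanti 0 2, hanti 2 1, hanti 1 0]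
    simp only [neg_one_mul]
    rw [Multiset.cons_swap]

/-! ### Equal weights give a `G`-map -/

/-- Equal multiplicities make the fibres equinumerous; bijections of fibres glue to a permutation.
-/
theorem exists_perm_of_map_eq {α β : Type*} [Fintype α] {f g : α → β}
    (h : Finset.univ.val.map f = Finset.univ.val.map g) : ∃ σ : Equiv.Perm α, ∀ a, g (σ a) = f a := by
  classical
  have hcard (b : β) : Fintype.card {a // f a = b} = Fintype.card {a // g a = b} := by
    have := congrArg (Multiset.count b) h
    rw [Multiset.count_map, Multiset.count_map] at this
    rw [Fintype.card_subtype, Fintype.card_subtype, Finset.card_def, Finset.card_def,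
      Finset.filter_val, Finset.filter_val]
    simpa only [eq_comm] using this
  exact ⟨Equiv.ofFiberEquiv fun b => Fintype.equivOfCardEq (hcard b),
    Equiv.ofFiberEquiv_map _⟩

theorem area_comp_perm (Q : Fin 3 → Fin 2 → ℤ) (σ : Equiv.Perm (Fin 3)) :
    area (Q ∘ σ) * area (Q ∘ σ) = area Q * area Q := by
  have : ∀ σ : Equiv.Perm (Fin 3),
      (σ 0 = 0 ∧ σ 1 = 1 ∧ σ 2 = 2) ∨ (σ 0 = 0 ∧ σ 1 = 2 ∧ σ 2 = 1) ∨
      (σ 0 = 1 ∧ σ 1 = 0 ∧ σ 2 = 2) ∨ (σ 0 = 1 ∧ σ 1 = 2 ∧ σ 2 = 0) ∨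
      (σ 0 = 2 ∧ σ 1 = 0 ∧ σ 2 = 1) ∨ (σ 0 = 2 ∧ σ 1 = 1 ∧ σ 2 = 0) := by decide
  rcases this σ with ⟨h0, h1, h2⟩ | ⟨h0, h1, h2⟩ | ⟨h0, h1, h2⟩ | ⟨h0, h1, h2⟩ | ⟨h0, h1, h2⟩ |
    ⟨h0, h1, h2⟩ <;>
  simp only [area, cross, Function.comp_apply, h0, h1, h2, Pi.sub_apply] <;>
  ring

theorem exists_linear_map (P Q : Fin 3 → Fin 2 → ℤ) (hP : area P * area P = 1)
    (hQ : area Q * area Q = 1) : ∃ U : GL (Fin 2) ℤ, ∀ i, U.val *ᵥ (P i - P 0) = Q i - Q 0 := by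
  -- The matrix of `Q`-edges times the inverse of the matrix of `P`-edges; the inverse is integral
  -- because `area P` is its own inverse.
  set U : Matrix (Fin 2) (Fin 2) ℤ := area P •
    !![(P 2 - P 0) 1 * (Q 1 - Q 0) 0 - (P 1 - P 0) 1 * (Q 2 - Q 0) 0,
        (P 1 - P 0) 0 * (Q 2 - Q 0) 0 - (P 2 - P 0) 0 * (Q 1 - Q 0) 0;
      (P 2 - P 0) 1 * (Q 1 - Q 0) 1 - (P 1 - P 0) 1 * (Q 2 - Q 0) 1,
        (P 1 - P 0) 0 * (Q 2 - Q 0) 1 - (P 2 - P 0) 0 * (Q 1 - Q 0) 1] with hU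
  have hmul (x : Fin 2 → ℤ) : U *ᵥ x =
      area P • (cross x (P 2 - P 0) • (Q 1 - Q 0) + cross (P 1 - P 0) x • (Q 2 - Q 0)) := by
    rw [hU, Matrix.smul_mulVec]
    congr 1
    funext j
    fin_cases j <;>
    · simp [Matrix.mulVec, dotProduct, Fin.sum_univ_two, cross]
      ring
  have hdet : U.det = area P * area P * (area P * area Q) := by
    rw [hU, Matrix.det_smul, Matrix.det_fin_two_of, Fintype.card_fin, sq]
    congr 1
    simp only [area, cross]
    ring
  have hunit : IsUnit U := by
    rw [Matrix.isUnit_iff_isUnit_det, hdet, hP, one_mul]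
    exact (IsUnit.of_mul_eq_one _ hP).mul (IsUnit.of_mul_eq_one _ hQ)
  refine ⟨hunit.unit, fun i => ?_⟩
  rw [IsUnit.unit_spec, hmul]
  have hself (x : Fin 2 → ℤ) : cross x x = 0 := by simp only [cross]; ring
  have harea : cross (P 1 - P 0) (P 2 - P 0) = area P := rfl
  fin_cases i
  · simp [cross]
  · simp only [Fin.mk_one, harea, hself, zero_smul, add_zero, smul_smul, hP, one_smul]
  · simp only [Fin.reduceFinMk, harea, hself, zero_smul, zero_add, smul_smul, hP, one_smul]

theorem gEquivalent_of_originCoord {d : ℕ} (hd : 0 < d) {S T : Affine.Triangle ℝ Plane}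
    {P Q : Fin 3 → Fin 2 → ℤ} (hS : HasVertices d S P) (hT : HasVertices d T Q)
    (hP : area P * area P = 1) (hQ : area Q * area Q = 1) (σ : Equiv.Perm (Fin 3))
    (hσ : ∀ i, (originCoord Q (σ i) : ZMod d) = originCoord P i) :
    GEquivalent (region S) (region T) := by
  have hd' : (d : ℝ) ≠ 0 := by exact_mod_cast hd.ne'
  obtain ⟨U, hU⟩ := exists_linear_map P (Q ∘ σ) hP ((area_comp_perm Q σ).trans hQ)
  set w := Q (σ 0) - U.val *ᵥ P 0 with hw
  have hUi (i) : Q (σ i) = U.val *ᵥ P i + w := by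
    have := hU i
    rw [Matrix.mulVec_sub, Function.comp_apply, Function.comp_apply] at this
    rw [hw, ← sub_add_cancel (Q (σ i)) (Q (σ 0)), ← this]
    abel
  -- Map the expansion of the origin in the `P i` to obtain `w`, then subtract the expansion of the
  -- origin in the `Q (σ i)`. Each coefficient is divisible by `d`, by `hσ`.
  have hw' : w = ∑ i, (originCoord P i - originCoord Q (σ i)) • Q (σ i) := by
    have h1 : ∑ i, originCoord Q (σ i) • Q (σ i) = 0 :=
      (Equiv.sum_comp σ fun i => originCoord Q i • Q i).trans (sum_originCoord_smul Q)
    have h2 : ∑ i, originCoord P i = 1 := by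
      rw [Fin.sum_univ_three]
      exact originCoord_add P hP 0
    simp only [sub_smul, Finset.sum_sub_distrib, h1, sub_zero]
    simp only [hUi, smul_add, Finset.sum_add_distrib, ← Finset.sum_smul, h2, one_smul,
      ← Matrix.mulVec_smul, ← Matrix.mulVec_sum, sum_originCoord_smul, Matrix.mulVec_zero, zero_add]
  have hdvd (j) : (d : ℤ) ∣ w j := by
    rw [hw', Finset.sum_apply]
    refine Finset.dvd_sum fun i _ => Dvd.dvd.mul_right ?_ _
    rw [← ZMod.intCast_eq_intCast_iff_dvd_sub, hσ]
  choose v hv using hdvd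
  have hmap (i) : gMap U v (S.points i) = T.points (σ i) := by
    funext j
    have := congrArg (Int.cast : ℤ → ℝ) (congrFun (hUi i) j)
    rw [hT, this, Pi.add_apply, hv j]
    simp only [gMap, Pi.add_apply, Matrix.mulVec, dotProduct, Fin.sum_univ_two, Matrix.map_apply,
      hS _ _]
    push_cast
    field_simp
  refine ⟨gMap U v, ⟨U, v, rfl⟩, ?_⟩
  have himage : gMap U v '' range S.points = range T.points := by
    rw [← range_comp, ← σ.surjective.range_comp T.points]
    exact congrArg range (funext hmap)
  rw [region, region, ← himage]
  exact (gAffine U v).image_convexHull _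

/-! ### Decomposition of a triangle into open faces -/

/-- The relative interior of the face of a simplex with vertex set `s`. -/
def openFace (v : Fin 3 → Plane) (s : Finset (Fin 3)) : Set Plane :=
  {x | ∃ w : Fin 3 → ℝ, (∀ i ∈ s, 0 < w i) ∧ (∀ i ∉ s, w i = 0) ∧ ∑ i, w i = 1 ∧
    ∑ i, w i • v i = x}

theorem openFace_eq_openSimplex (v : Fin 3 → Plane) (s : Finset (Fin 3)) {k : ℕ}
    (h : s.card = k + 1) : openFace v s = openSimplex (v ∘ s.orderEmbOfFin h) := by
  have hsum {M : Type} [AddCommMonoid M] (f : Fin 3 → M) (hf : ∀ i ∉ s, f i = 0) :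
      ∑ j, f (s.orderEmbOfFin h j) = ∑ i, f i :=
    calc ∑ j, f (s.orderEmbOfFin h j) = ∑ i : s, f i :=
          Equiv.sum_comp (s.orderIsoOfFin h).toEquiv fun i : s => f i
      _ = ∑ i ∈ s, f i := Finset.sum_coe_sort s f
      _ = ∑ i, f i := Finset.sum_subset (Finset.subset_univ s) fun i _ hi => hf i hi
  ext x
  constructor
  · rintro ⟨w, hw, hw0, h1, rfl⟩
    exact ⟨w ∘ s.orderEmbOfFin h, fun j => hw _ (s.orderEmbOfFin_mem h j),
      (hsum w hw0).trans h1, hsum (fun i => w i • v i) fun i hi => by rw [hw0 i hi, zero_smul]⟩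
  · rintro ⟨w, hw, h1, rfl⟩
    have hinj := (s.orderEmbOfFin h).injective
    -- Weights on the face extend by zero to the other vertices.
    set w' : Fin 3 → ℝ := Function.extend (s.orderEmbOfFin h) w 0
    have hw' (j) : w' (s.orderEmbOfFin h j) = w j := hinj.extend_apply _ _ _
    have h0 (i) (hi : i ∉ s) : w' i = 0 := Function.extend_apply' _ _ _ fun ⟨j, hj⟩ =>
      hi (hj ▸ s.orderEmbOfFin_mem h j)
    refine ⟨w', fun i hi => ?_, h0, ?_, ?_⟩
    · obtain ⟨j, rfl⟩ : i ∈ range (s.orderEmbOfFin h) := by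
        rw [Finset.range_orderEmbOfFin]; exact hi
      rw [hw']
      exact hw j
    · rw [← hsum w' h0, ← h1]
      exact Finset.sum_congr rfl fun j _ => hw' j
    · rw [← hsum (fun i => w' i • v i) fun i hi => by rw [h0 i hi, zero_smul]]
      exact Finset.sum_congr rfl fun j _ => by rw [hw' j]; rfl

theorem isRationalOpenSimplex_openFace {d : ℕ} {T : Affine.Triangle ℝ Plane}
    {P : Fin 3 → Fin 2 → ℤ} (hP : HasVertices d T P) {s : Finset (Fin 3)} (hs : s.Nonempty) :
    IsRationalOpenSimplex (openFace T.points s) := by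
  obtain ⟨k, hk⟩ := Nat.exists_eq_add_one_of_ne_zero hs.card_ne_zero
  refine ⟨k, T.points ∘ s.orderEmbOfFin hk,
    T.independent.comp_embedding (s.orderEmbOfFin hk).toEmbedding, fun i j => ?_,
    openFace_eq_openSimplex _ _ hk⟩
  exact ⟨(P (s.orderEmbOfFin hk i) j : ℚ) / d, by
    rw [Function.comp_apply, hP]; push_cast; rfl⟩

theorem disjoint_openFace {v : Fin 3 → Plane} (hv : AffineIndependent ℝ v) {s t : Finset (Fin 3)}
    (hst : s ≠ t) : Disjoint (openFace v s) (openFace v t) := by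
  rw [Set.disjoint_left]
  rintro _ ⟨w, hw, hw0, h1, rfl⟩ ⟨w', hw', hw0', h1', h⟩
  refine hst (Finset.ext fun i => ?_)
  have := (affineIndependent_iff.1 hv) Finset.univ (w - w')
    (by simp [Finset.sum_sub_distrib, h1, h1'])
    (by simp [sub_smul, Finset.sum_sub_distrib, h]) i (Finset.mem_univ i)
  rw [Pi.sub_apply, sub_eq_zero] at this
  constructor
  · intro hi
    by_contra hi'
    exact (hw i hi).ne' (this.trans (hw0' i hi'))
  · intro hi
    by_contra hi'
    exact (hw' i hi).ne' (this.symm.trans (hw0 i hi'))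

/-- The face containing a point is spanned by the vertices of positive weight. -/
theorem region_eq_iUnion_openFace (T : Affine.Triangle ℝ Plane) :
    region T = ⋃ s : {s : Finset (Fin 3) // s.Nonempty}, openFace T.points s.1 := by
  classical
  ext x
  rw [mem_iUnion]
  constructor
  · intro hx
    rw [region, convexHull_range_eq_exists_affineCombination] at hx
    obtain ⟨s, w, hw, h1, rfl⟩ := hx
    rw [s.affineCombination_eq_linear_combination _ _ h1]
    have hsub (i) (hi : i ∈ s) (hi' : i ∉ s.filter (0 < w ·)) : w i = 0 := by
      rw [Finset.mem_filter, not_and, not_lt] at hi'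
      exact le_antisymm (hi' hi) (hw i hi)
    have h1' : ∑ i ∈ s.filter (0 < w ·), w i = 1 := by
      rw [← h1]
      exact Finset.sum_subset (Finset.filter_subset _ _) hsub
    refine ⟨⟨s.filter (0 < w ·), Finset.nonempty_of_sum_ne_zero (h1'.trans_ne one_ne_zero)⟩,
      fun i => if i ∈ s.filter (0 < w ·) then w i else 0, fun i hi => ?_, fun i hi => if_neg hi,
      ?_, ?_⟩
    · exact (Finset.mem_filter.1 hi).2.trans_eq (if_pos hi).symm
    · rw [← Finset.sum_filter, Finset.filter_univ_mem, h1']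
    · simp only [ite_smul, zero_smul]
      rw [← Finset.sum_filter, Finset.filter_univ_mem]
      exact Finset.sum_subset (Finset.filter_subset _ _) fun i hi hi' => by
        rw [hsub i hi hi', zero_smul]
  · rintro ⟨s, w, hw, h0, h1, rfl⟩
    refine mem_region_of_weights (fun i => ?_) h1
    by_cases hi : i ∈ s.1
    · exact (hw i hi).le
    · exact (h0 i hi).ge

theorem equidecomposable_of_gEquivalent {d : ℕ} {T : Affine.Triangle ℝ Plane}
    {P : Fin 3 → Fin 2 → ℤ} (hP : HasVertices d T P) {Q : Set Plane}
    (hQ : GEquivalent (region T) Q) : FiniteRationalEquidecomposable (region T) Q := by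
  obtain ⟨g, ⟨U, v, rfl⟩, rfl⟩ := hQ
  set e := Fintype.equivFin {s : Finset (Fin 3) // s.Nonempty}
  have hdis : Pairwise fun i j => Disjoint (openFace T.points (e.symm i).1)
      (openFace T.points (e.symm j).1) := fun i j hij =>
    disjoint_openFace T.independent fun h' => hij (e.symm.injective (Subtype.ext h'))
  have hun : region T = ⋃ i, openFace T.points (e.symm i).1 := by
    rw [region_eq_iUnion_openFace]
    exact (e.symm.surjective.iUnion_comp fun s => openFace T.points s.1).symm
  refine ⟨_, fun i => openFace T.points (e.symm i).1, fun _ => gMap U v,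
    fun i => isRationalOpenSimplex_openFace hP (e.symm i).2, fun _ => ⟨U, v, rfl⟩, hdis, hun,
    fun i j hij => (Set.disjoint_image_iff (gMap_injective U v)).2 (hdis hij), ?_⟩
  rw [hun, image_iUnion]

/-! ### The implications between the three conditions -/

theorem weight_eq_of_equidecomposable {d : ℕ} (hd : 0 < d) {S T : Affine.Triangle ℝ Plane}
    (hS : IsMinimal d S) (hT : IsMinimal d T)
    (h : FiniteRationalEquidecomposable (region S) (region T)) : weight d S = weight d T := by
  classical
  obtain ⟨P, hSP, hP⟩ := exists_vertices_of_minimal hd hS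
  obtain ⟨Q, hTQ, hQ⟩ := exists_vertices_of_minimal hd hT
  have hd' : -(1 / d : ℝ) ≠ 0 := neg_ne_zero.2 (one_div_ne_zero (by exact_mod_cast hd.ne'))
  rw [weight_eq hd hSP hP, weight_eq hd hTQ hQ]
  ext a
  obtain ⟨a, rfl⟩ := ZMod.intCast_surjective a
  have key := totalJump_eq_of_equidecomposable h (a / d)
  rw [totalJump_region hd hSP hP, totalJump_region hd hTQ hQ] at key
  simp only [← Finset.sum_filter, Finset.sum_const, nsmul_eq_mul] at key
  -- Cancelling the common factor `-(1 / d)` leaves the multiplicities of `a` in the two weights.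
  have key' := Nat.cast_injective (mul_right_cancel₀ hd' key)
  rw [Multiset.count_map, Multiset.count_map]
  simpa only [eq_comm, Finset.card_def, Finset.filter_val] using key'

theorem gEquivalent_of_weight_eq {d : ℕ} (hd : 0 < d) {S T : Affine.Triangle ℝ Plane}
    (hS : IsMinimal d S) (hT : IsMinimal d T) (h : weight d S = weight d T) :
    GEquivalent (region S) (region T) := by
  obtain ⟨P, hSP, hP⟩ := exists_vertices_of_minimal hd hS
  obtain ⟨Q, hTQ, hQ⟩ := exists_vertices_of_minimal hd hT
  rw [weight_eq hd hSP hP, weight_eq hd hTQ hQ] at h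
  obtain ⟨σ, hσ⟩ := exists_perm_of_map_eq h
  exact gEquivalent_of_originCoord hd hSP hTQ hP hQ σ hσ

end DiscreteEqui

end

theorem mainTheorem6 (d : ℕ) (hd : 0 < d)
    (S T : Affine.Triangle ℝ DiscreteEqui.Plane)
    (hS : DiscreteEqui.IsMinimal d S) (hT : DiscreteEqui.IsMinimal d T) :
    List.TFAE [
      DiscreteEqui.GEquivalent (DiscreteEqui.region S) (DiscreteEqui.region T),
      DiscreteEqui.weight d S = DiscreteEqui.weight d T,
      DiscreteEqui.FiniteRationalEquidecomposable
        (DiscreteEqui.region S) (DiscreteEqui.region T)] := by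
  obtain ⟨P, hSP, -⟩ := DiscreteEqui.exists_vertices_of_minimal hd hS
  tfae_have 1 → 3 := DiscreteEqui.equidecomposable_of_gEquivalent hSP
  tfae_have 3 → 2 := DiscreteEqui.weight_eq_of_equidecomposable hd hS hT
  tfae_have 2 → 1 := DiscreteEqui.gEquivalent_of_weight_eq hd hS hT
  tfae_finish
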